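/- For real $s\ge 0$ let $D^s$ be the Fourier multiplier $\widehat{D^s\varphi}(\xi)=|\xi|^s\widehat\varphi(\xi)$ on $\mathbb R^d$, where $\widehat\varphi(\xi)=\int_{\mathbb R^d} e^{-2\pi i x\cdot\xi}\varphi(x)\,dx$ (extended to $L^2$), and let $H^S(\mathbb R^d)$ be the inhomogeneous $L^2$-based Sobolev space of order $S$. Let $d\ge 2$ be an integer and let $r,S$ be real numbers with $\frac12<r<\min\left(\frac d2,\,S-\frac12\right)$. Put $$p_0=\frac{d-2r+2(S-r)(d-1)}{-\left((S-r)-\frac12\right)(d-2r)+2(S-r)(d-1)}.$$ Then $p_0<2$. Moreover, let $p$ be a real number such that $$p\in\left(p_0,\ \frac{2d}{d-2(S-r)}\right]\ \text{ if } S-r<\frac d2,\qquad p\in(p_0,\infty)\ \text{ if } S-r\ge\frac d2,$$ and let $\theta$ be determined by $\frac1p=\frac12+\frac{r-\theta S}{d}$. Then there is a constant $C>0$, depending only on $r,S,p,d$, such that $$\|D^r\varphi\|_{L^p(\mathbb R^d)}\le C\,\|\varphi\|_{L^2(\mathbb R^d)}^{1-\theta}\,\|D^S\varphi\|_{L^2(\mathbb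 R^d)}^{\theta}$$ for every radially symmetric $\varphi\in H^S(\mathbb R^d)$ such that $D^r\varphi\ge 0$ almost everywhere or $D^r\varphi\le 0$ almost everywhere. -/

import Mathlib

open MeasureTheory FourierTransform
open scoped ENNReal SchwartzMap

noncomputable section

/-- Complex-valued square-integrable functions on `ℝ^d` (with the Euclidean norm). -/
abbrev L2 (d : ℕ) : Type :=
  Lp ℂ 2 (volume : Measure (EuclideanSpace ℝ (Fin d)))

/-- The function `ξ ↦ |ξ|^s φ̂(ξ)`, with `φ̂` the `L²` Fourier transform
(kernel `exp (-2πi x·ξ)`). -/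
def fracSymbol {d : ℕ} (s : ℝ) (φ : L2 d) : EuclideanSpace ℝ (Fin d) → ℂ :=
  fun ξ => ((‖ξ‖ ^ s : ℝ) : ℂ) * (𝓕 φ : L2 d) ξ

open Classical in
/-- `D^s φ`: the `L²` function whose Fourier transform is `|ξ|^s φ̂(ξ)`, whenever that function is
square-integrable (junk value `0` otherwise). For `φ ∈ H^S` and `0 ≤ s ≤ S` the junk value does not
occur, see `fourier_fracDeriv`. -/
def fracDeriv {d : ℕ} (s : ℝ) (φ : L2 d) : L2 d :=
  if h : MemLp (fracSymbol s φ) 2 volume then (𝓕⁻ (h.toLp (fracSymbol s φ)) : L2 d) else 0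

/-- The inhomogeneous Sobolev space `H^S(ℝ^d)`, `S ≥ 0`, as a set of square-integrable functions. -/
def sobolevH (d : ℕ) (S : ℝ) : Set (L2 d) :=
  {φ | TemperedDistribution.MemSobolev S 2 (φ : 𝓢'(EuclideanSpace ℝ (Fin d), ℂ))}

/-- `φ` is (a.e. equal to) a function of `|x|`. -/
def IsRadial {d : ℕ} (φ : L2 d) : Prop :=
  ∃ f : ℝ → ℂ, ∀ᵐ x ∂(volume : Measure (EuclideanSpace ℝ (Fin d))), φ x = f ‖x‖

/-- `u` is real-valued and nonnegative almost everywhere. -/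
def IsNonneg {d : ℕ} (u : L2 d) : Prop :=
  ∀ᵐ x ∂(volume : Measure (EuclideanSpace ℝ (Fin d))), (u x).im = 0 ∧ 0 ≤ (u x).re

/-- `u` is real-valued and nonpositive almost everywhere. -/
def IsNonpos {d : ℕ} (u : L2 d) : Prop :=
  ∀ᵐ x ∂(volume : Measure (EuclideanSpace ℝ (Fin d))), (u x).im = 0 ∧ (u x).re ≤ 0

/-- `H^{S,r}_{rad,+}(ℝ^d)`: radial functions in `H^S` with `D^r φ ≥ 0`. -/
def sobolevRadPlus (d : ℕ) (S r : ℝ) : Set (L2 d) :=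
  {φ | φ ∈ sobolevH d S ∧ IsRadial φ ∧ IsNonneg (fracDeriv r φ)}

/-- `H^{S,r}_{rad,-}(ℝ^d)`: radial functions in `H^S` with `D^r φ ≤ 0`. -/
def sobolevRadMinus (d : ℕ) (S r : ℝ) : Set (L2 d) :=
  {φ | φ ∈ sobolevH d S ∧ IsRadial φ ∧ IsNonpos (fracDeriv r φ)}

/-- The lower endpoint exponent `p₀`. -/
def lowerExponent (d : ℕ) (r S : ℝ) : ℝ :=
  ((d : ℝ) - 2 * r + 2 * (S - r) * ((d : ℝ) - 1)) /
    (-((S - r) - 1 / 2) * ((d : ℝ) - 2 * r) + 2 * (S - r) * ((d : ℝ) - 1))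

/-- For `φ ∈ H^S` and `0 ≤ s ≤ S`, the function `|ξ|^s φ̂(ξ)` is square-integrable. -/
theorem memLp_fracSymbol {d : ℕ} {s S : ℝ} (hs : 0 ≤ s) (hsS : s ≤ S) {φ : L2 d}
    (hφ : φ ∈ sobolevH d S) : MemLp (fracSymbol s φ) 2 volume := by
  have h0 := TemperedDistribution.memSobolev_iff_exists_smulLeftCLM_fourier.mp
    (show TemperedDistribution.MemSobolev S 2 (φ : 𝓢'(EuclideanSpace ℝ (Fin d), ℂ)) from hφ)
  obtain ⟨f', hf'⟩ := h0
  set g : EuclideanSpace ℝ (Fin d) → ℂ :=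
    fun x => (((1 + ‖x‖ ^ 2) ^ (-S / 2) : ℝ) : ℂ) with hg
  have hgt : g.HasTemperateGrowth := by rw [hg]; fun_prop
  have hS : 0 ≤ S := hs.trans hsS
  have hgb : ∀ x, ‖g x‖ ≤ 1 := by
    intro x
    rw [hg, Complex.norm_real, Real.norm_eq_abs, abs_eq_self.mpr (by positivity)]
    exact Real.rpow_le_one_of_one_le_of_nonpos (by simp) (by linarith)
  have hgm : MemLp g ∞ (volume : Measure (EuclideanSpace ℝ (Fin d))) :=
    memLp_top_of_bound hgt.1.continuous.aestronglyMeasurable 1 (Filter.Eventually.of_forall hgb)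
  have hkey : (hgm.toLp g • f' : L2 d) = (𝓕 φ : L2 d) := by
    apply LinearMap.ker_eq_bot.mp
      (MeasureTheory.Lp.ker_toTemperedDistributionCLM_eq_bot (F := ℂ)
        (μ := (volume : Measure (EuclideanSpace ℝ (Fin d)))) (p := 2))
    change ((hgm.toLp g • f' : L2 d) : 𝓢'(EuclideanSpace ℝ (Fin d), ℂ)) =
      ((𝓕 φ : L2 d) : 𝓢'(EuclideanSpace ℝ (Fin d), ℂ))
    rw [MeasureTheory.Lp.toTemperedDistribution_smul_eq hgt, ← hf',
      TemperedDistribution.smulLeftCLM_smulLeftCLM_apply (by fun_prop) hgt,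
      ← MeasureTheory.Lp.fourier_toTemperedDistribution_eq]
    convert TemperedDistribution.smulLeftCLM_const (1 : ℂ)
      (𝓕 (φ : 𝓢'(EuclideanSpace ℝ (Fin d), ℂ))) using 2
    · congr 1
      ext x
      simp only [Pi.mul_apply, hg]
      norm_cast
      rw [← Real.rpow_add (by positivity)]
      ring_nf
      simp
    · simp
  have hae : ∀ᵐ x ∂(volume : Measure (EuclideanSpace ℝ (Fin d))), (𝓕 φ : L2 d) x = g x * f' x := by
    rw [← hkey]
    filter_upwards [Lp.coeFn_lpSMul (r := 2) (hgm.toLp g) f', hgm.coeFn_toLp] with x h1 h2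
    rw [h1, Pi.smul_apply', h2, smul_eq_mul]
  refine MemLp.of_le (Lp.memLp f') ?_ ?_
  · refine AEStronglyMeasurable.mul ?_ (Lp.aestronglyMeasurable _)
    exact (Complex.measurable_ofReal.comp (measurable_norm.pow_const s)).aestronglyMeasurable
  · filter_upwards [hae] with x hx
    have h1 : ‖x‖ ^ s ≤ (1 + ‖x‖ ^ 2) ^ (S / 2) := by
      calc ‖x‖ ^ s = (‖x‖ ^ 2) ^ (s / 2) := by
            rw [← Real.rpow_natCast, ← Real.rpow_mul (norm_nonneg x)]
            congr 1
            push_cast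
            ring
        _ ≤ (1 + ‖x‖ ^ 2) ^ (s / 2) :=
            Real.rpow_le_rpow (by positivity) (by linarith) (by positivity)
        _ ≤ (1 + ‖x‖ ^ 2) ^ (S / 2) :=
            Real.rpow_le_rpow_of_exponent_le (by nlinarith [sq_nonneg ‖x‖]) (by linarith)
    have h2 : ‖g x‖ = (1 + ‖x‖ ^ 2) ^ (-S / 2) := by
      rw [hg, Complex.norm_real, Real.norm_eq_abs, abs_eq_self.mpr (by positivity)]
    have h3 : ‖x‖ ^ s * ‖g x‖ ≤ 1 := by
      rw [h2]
      calc ‖x‖ ^ s * (1 + ‖x‖ ^ 2) ^ (-S / 2)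
          ≤ (1 + ‖x‖ ^ 2) ^ (S / 2) * (1 + ‖x‖ ^ 2) ^ (-S / 2) := by gcongr
        _ = 1 := by rw [← Real.rpow_add (by positivity)]; ring_nf; simp
    rw [fracSymbol, hx, norm_mul, norm_mul, Complex.norm_real, Real.norm_eq_abs,
      abs_eq_self.mpr (by positivity), ← mul_assoc]
    exact mul_le_of_le_one_left (norm_nonneg _) h3

/-- For `φ ∈ H^S` and `0 ≤ s ≤ S`, the Fourier transform of `D^s φ` is `|ξ|^s φ̂(ξ)`. -/
theorem fourier_fracDeriv {d : ℕ} {s S : ℝ} (hs : 0 ≤ s) (hsS : s ≤ S) {φ : L2 d}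
    (hφ : φ ∈ sobolevH d S) :
    ∀ᵐ ξ ∂(volume : Measure (EuclideanSpace ℝ (Fin d))),
      (𝓕 (fracDeriv s φ) : L2 d) ξ = ((‖ξ‖ ^ s : ℝ) : ℂ) * (𝓕 φ : L2 d) ξ := by
  have h := memLp_fracSymbol hs hsS hφ
  rw [fracDeriv, dif_pos h, FourierTransform.fourier_fourierInv_eq]
  exact h.coeFn_toLp

end

/-! For `p > 2` neither symmetry nor sign matters. With `σ = d(1/2 - 1/p)`, the critical Sobolev
inequality `lintegral_rpow_le_sobolev` bounds the `L^p` norm of `D^r φ` by the `L²` norm of `D^(r+σ)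
φ`. Since `θ S = r + σ ≤ S`, Hölder on the Fourier side (`norm_fracDeriv_le_interpolation`)
concludes.

For `p ≤ 2` the issue is decay at infinity. Up to a unimodular constant, `D^r φ` is `v(x) = f(|x|)`
with `f ≥ 0`. Put `σ = S - r`. Two facts drive the argument. Because `v` has no cancellation,
testing it against a Gaussian of width `R` shows that its mass in the ball of radius `R` is at most
`C R^(d/2-r) ‖φ‖` (`setLIntegral_ball_profile_le`). And its differences `Δ_h` of order `m ≥ σ` have
`L²` norm at most `C |h|^σ ‖D^S φ‖` (`lintegral_finiteDiff_le`).

On the annulus `|x| ~ R`, positivity gives `v(x)² ≤ |Δ_h v(x)|² + C v(x) ∑ v(x + jh)`. Average this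
over `h = te`, `0 < t < δ`, where `e` makes an angle with `x` that stays below and away from `π/2`.
By radial symmetry the integral of `v(x + jte)` in `t` is controlled by a one-dimensional integral
of `f`, hence by `R^(-(d-1))` times the mass. With the norms normalized, the square integral of `v`
over the annulus is `O(δ^(2σ) + δ⁻¹ R^(1-2r))`, and the best `δ` turns this into `R^(-β)` with `β =
2σ(2r-1)/(2σ+1)` (`exists_setLIntegral_annulus_le`).

Interpolation with the mass bound `R^α`, `α = d/2 - r`, bounds the integral of `v^p` over the
annulus by `R^(-κ)`, `κ = (p-1)(α+β) - α`. The condition `κ > 0` is exactly `p > p₀`, and then the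
dyadic annuli sum geometrically. A change of length scale and amplitude restores the norms of `φ`.
-/

noncomputable section

/-! ### The `L²` Fourier transform: Fourier integrals, translations, isometries -/

/-- The `L²` Fourier transform is self-adjoint for the bilinear pairing with Schwartz functions. -/
theorem integral_schwartz_mul_fourier {d : ℕ} (u : L2 d) (ψ : 𝓢(EuclideanSpace ℝ (Fin d), ℂ)) :
    ∫ x, ψ x * (𝓕 u : L2 d) x = ∫ x, (𝓕 ψ) x * u x := by
  have h := congrArg (fun T : 𝓢'(EuclideanSpace ℝ (Fin d), ℂ) => T ψ)
    (Lp.fourier_toTemperedDistribution_eq u)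
  simp only [TemperedDistribution.fourier_apply, Lp.toTemperedDistribution_apply,
    smul_eq_mul] at h
  exact h.symm

theorem integral_schwartz_mul_fourierInv {d : ℕ} (u : L2 d)
    (ψ : 𝓢(EuclideanSpace ℝ (Fin d), ℂ)) :
    ∫ x, ψ x * (𝓕⁻ u : L2 d) x = ∫ x, (𝓕⁻ ψ) x * u x := by
  have h := congrArg (fun T : 𝓢'(EuclideanSpace ℝ (Fin d), ℂ) => T ψ)
    (Lp.fourierInv_toTemperedDistribution_eq u)
  simp only [TemperedDistribution.fourierInv_apply, Lp.toTemperedDistribution_apply,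
    smul_eq_mul] at h
  exact h.symm

/-- Locally integrable functions with the same pairing against Schwartz functions agree a.e. -/
theorem ae_eq_of_integral_schwartz_mul_eq {d : ℕ} {f g : EuclideanSpace ℝ (Fin d) → ℂ}
    (hf : LocallyIntegrable f) (hg : LocallyIntegrable g)
    (h : ∀ ψ : 𝓢(EuclideanSpace ℝ (Fin d), ℂ), ∫ x, ψ x * f x = ∫ x, ψ x * g x) :
    f =ᵐ[volume] g := by
  refine ae_eq_of_integral_contDiff_smul_eq hf hg fun η hη hs => ?_
  have hs' : HasCompactSupport (Complex.ofRealCLM ∘ η) := hs.comp_left rfl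
  have hη' : ContDiff ℝ (⊤ : ℕ∞) (Complex.ofRealCLM ∘ η) := by fun_prop
  simpa using h (hs'.toSchwartzMap hη')

theorem locallyIntegrable_coe_L2 {d : ℕ} (u : L2 d) :
    LocallyIntegrable (u : EuclideanSpace ℝ (Fin d) → ℂ) :=
  (Lp.memLp u).locallyIntegrable (by norm_num)

/-- For `f ∈ L¹ ∩ L²`, the `L²` Fourier transform is given by the Fourier integral. -/
theorem fourier_toLp_ae_eq {d : ℕ} {f : EuclideanSpace ℝ (Fin d) → ℂ} (hf : Integrable f)
    (hf2 : MemLp f 2 volume) : (𝓕 (hf2.toLp f) : L2 d) =ᵐ[volume] 𝓕 f := by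
  have hc : Continuous (𝓕 f) :=
    VectorFourier.fourierIntegral_continuous Real.continuous_fourierChar
      (by exact continuous_inner) hf
  refine ae_eq_of_integral_schwartz_mul_eq (locallyIntegrable_coe_L2 _) hc.locallyIntegrable
    fun ψ => ?_
  rw [integral_schwartz_mul_fourier]
  have h1 : ∫ x, (𝓕 ψ) x * (hf2.toLp f) x = ∫ x, (𝓕 ψ) x * f x := by
    refine integral_congr_ae ?_
    filter_upwards [hf2.coeFn_toLp] with x hx
    rw [hx]
  rw [h1]
  have := VectorFourier.integral_bilin_fourierIntegral_eq_flip (ContinuousLinearMap.mul ℂ ℂ)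
    (L := innerₗ (EuclideanSpace ℝ (Fin d))) (μ := volume) (ν := volume) (e := Real.fourierChar)
    Real.continuous_fourierChar (by exact continuous_inner) ψ.integrable hf
  rw [flip_innerₗ] at this
  exact this

theorem fourierInv_toLp_ae_eq {d : ℕ} {f : EuclideanSpace ℝ (Fin d) → ℂ} (hf : Integrable f)
    (hf2 : MemLp f 2 volume) : (𝓕⁻ (hf2.toLp f) : L2 d) =ᵐ[volume] 𝓕⁻ f := by
  have hmp : MeasurePreserving (fun x : EuclideanSpace ℝ (Fin d) => -x) volume volume :=
    Measure.measurePreserving_neg _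
  have hc : Continuous (𝓕⁻ f) := by
    have : Continuous (𝓕 f) := VectorFourier.fourierIntegral_continuous Real.continuous_fourierChar
      (by exact continuous_inner) hf
    have h2 : 𝓕⁻ f = fun x => 𝓕 f (-x) := by
      ext x; rw [Real.fourierInv_eq_fourier_neg]
    rw [h2]; fun_prop
  refine ae_eq_of_integral_schwartz_mul_eq (locallyIntegrable_coe_L2 _) hc.locallyIntegrable
    fun ψ => ?_
  rw [integral_schwartz_mul_fourierInv]
  have h1 : ∫ x, (𝓕⁻ ψ) x * (hf2.toLp f) x = ∫ x, (𝓕⁻ ψ) x * f x := by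
    refine integral_congr_ae ?_
    filter_upwards [hf2.coeFn_toLp] with x hx
    rw [hx]
  rw [h1]
  -- The inverse transform is the Fourier integral for the negated inner product, so the same
  -- exchange formula applies.
  have := VectorFourier.integral_bilin_fourierIntegral_eq_flip (ContinuousLinearMap.mul ℂ ℂ)
    (L := -innerₗ (EuclideanSpace ℝ (Fin d))) (μ := volume) (ν := volume) (e := Real.fourierChar)
    Real.continuous_fourierChar (by exact continuous_inner.neg) ψ.integrable hf
  have e1 : ∀ g : EuclideanSpace ℝ (Fin d) → ℂ, VectorFourier.fourierIntegral Real.fourierChar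
      volume (-innerₗ (EuclideanSpace ℝ (Fin d))) g = 𝓕⁻ g := by
    intro g; ext x
    rw [Real.fourierInv_eq]; simp [VectorFourier.fourierIntegral]
  have e2 : (-innerₗ (EuclideanSpace ℝ (Fin d))).flip = -innerₗ (EuclideanSpace ℝ (Fin d)) := by
    ext x y; simp [real_inner_comm]
  rw [e2] at this
  simp only [e1] at this
  simpa [SchwartzMap.fourierInv_coe] using this

theorem norm_fourierInv_toLp_le {d : ℕ} {f : EuclideanSpace ℝ (Fin d) → ℂ} (hf : Integrable f)
    (hf2 : MemLp f 2 volume) : ∀ᵐ x, ‖(𝓕⁻ (hf2.toLp f) : L2 d) x‖ ≤ ∫ ξ, ‖f ξ‖ := by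
  filter_upwards [fourierInv_toLp_ae_eq hf hf2] with x hx
  rw [hx, Real.fourierInv_eq]
  refine (norm_integral_le_integral_norm _).trans (le_of_eq ?_)
  simp

theorem measurePreserving_add_const {d : ℕ} (h : EuclideanSpace ℝ (Fin d)) :
    MeasurePreserving (fun x : EuclideanSpace ℝ (Fin d) => x + h) volume volume :=
  measurePreserving_add_right volume h

/-- Translation `u ↦ u(· + h)` on `L²`. -/
def translateL2 {d : ℕ} (h : EuclideanSpace ℝ (Fin d)) (u : L2 d) : L2 d :=
  Lp.compMeasurePreserving (fun x => x + h) (measurePreserving_add_const h) u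

theorem coeFn_translate {d : ℕ} (h : EuclideanSpace ℝ (Fin d)) (u : L2 d) :
    translateL2 h u =ᵐ[volume] fun x => u (x + h) :=
  Lp.coeFn_compMeasurePreserving u (measurePreserving_add_const h)

/-- The `n`-th derivative has constant modulus `(2π)^n`, so degree `0` suffices in every growth
bound. This makes multiplication by a character an operator on Schwartz functions, as the duality
proof of `fourier_translate` requires. -/
theorem hasTemperateGrowth_fourierChar :
    Function.HasTemperateGrowth fun t : ℝ => ((Real.fourierChar t : Circle) : ℂ) := by
  set c : ℂ := 2 * Real.pi * Complex.I
  have e : (fun t : ℝ => ((Real.fourierChar t : Circle) : ℂ)) =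
      fun t : ℝ => Complex.exp (c * t) := by
    funext t
    rw [Real.fourierChar_apply]
    congr 1
    simp only [c]
    push_cast
    ring
  have hit : ∀ n : ℕ, iteratedDeriv n (fun t : ℝ => Complex.exp (c * t)) =
      fun t : ℝ => c ^ n * Complex.exp (c * t) := by
    intro n
    induction n with
    | zero => simp
    | succ n ih =>
      rw [iteratedDeriv_succ, ih]
      funext t
      have h1 : HasDerivAt (fun t : ℝ => c * (t : ℂ)) c t := by
        simpa using (Complex.ofRealCLM.hasDerivAt (x := t)).const_mul c
      have h2 := (h1.cexp.const_mul (c ^ n)).deriv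
      rw [h2]
      ring
  refine ⟨?_, fun n => ⟨0, ‖c‖ ^ n, fun x => ?_⟩⟩
  · rw [e]
    exact Complex.contDiff_exp.comp (contDiff_const.mul Complex.ofRealCLM.contDiff)
  · rw [norm_iteratedFDeriv_eq_norm_iteratedDeriv, e, hit]
    have hx := congrFun e x
    rw [norm_mul, ← hx, Circle.norm_coe, norm_pow]
    simp

theorem fourier_translate {d : ℕ} (h : EuclideanSpace ℝ (Fin d)) (u : L2 d) :
    (𝓕 (translateL2 h u) : L2 d) =ᵐ[volume]
      fun ξ => Complex.exp (2 * Real.pi * inner ℝ h ξ * Complex.I) * (𝓕 u : L2 d) ξ := by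
  set e : EuclideanSpace ℝ (Fin d) → ℂ :=
    fun ξ => Complex.exp (2 * Real.pi * inner ℝ h ξ * Complex.I) with he
  have hec : Continuous e := by rw [he]; fun_prop
  have hloc : LocallyIntegrable fun ξ => e ξ * (𝓕 u : L2 d) ξ := by
    have := (locallyIntegrable_coe_L2 (𝓕 u : L2 d))
    rw [← locallyIntegrableOn_univ] at this ⊢
    exact this.continuousOn_mul hec.continuousOn isOpen_univ.isLocallyClosed
  refine ae_eq_of_integral_schwartz_mul_eq (locallyIntegrable_coe_L2 _) hloc fun ψ => ?_
  have heg : e.HasTemperateGrowth := by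
    have : e = fun ξ => ((Real.fourierChar (inner ℝ h ξ) : Circle) : ℂ) := by
      ext ξ; simp [he, Real.fourierChar_apply]
    rw [this]
    exact hasTemperateGrowth_fourierChar.comp (by fun_prop)
  have key : ∫ x, ψ x * (e x * (𝓕 u : L2 d) x)
      = ∫ x, (SchwartzMap.smulLeftCLM ℂ e ψ) x * (𝓕 u : L2 d) x := by
    refine integral_congr_ae (Filter.Eventually.of_forall fun x => ?_)
    simp only [SchwartzMap.smulLeftCLM_apply_apply heg, smul_eq_mul]
    ring
  rw [key, integral_schwartz_mul_fourier, integral_schwartz_mul_fourier]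
  have h1 : ∫ x, (𝓕 ψ) x * (translateL2 h u) x = ∫ x, (𝓕 ψ) x * u (x + h) := by
    refine integral_congr_ae ?_
    filter_upwards [coeFn_translate h u] with x hx
    rw [hx]
  rw [h1]
  -- By duality the character now sits on `ψ`, where it translates `𝓕 ψ`; translation invariance of
  -- the integral moves the shift to `u`.
  refine Eq.trans ?_ (integral_add_right_eq_self
    (fun x => (𝓕 (SchwartzMap.smulLeftCLM ℂ e ψ)) x * u x) h)
  refine integral_congr_ae (Filter.Eventually.of_forall fun x => ?_)
  simp only
  congr 1
  simp only [SchwartzMap.fourier_coe, Real.fourier_eq']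
  refine integral_congr_ae (Filter.Eventually.of_forall fun v => ?_)
  beta_reduce
  rw [SchwartzMap.smulLeftCLM_apply_apply heg]
  simp only [smul_eq_mul, he]
  rw [← mul_assoc, ← Complex.exp_add]
  congr 2
  rw [inner_add_right, real_inner_comm v h]
  push_cast
  ring

/-- Composition with a linear isometry on `L²`. -/
def compIsometry {d : ℕ} (A : EuclideanSpace ℝ (Fin d) ≃ₗᵢ[ℝ] EuclideanSpace ℝ (Fin d))
    (u : L2 d) : L2 d :=
  Lp.compMeasurePreserving A A.measurePreserving u

theorem coeFn_compIsometry {d : ℕ}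
    (A : EuclideanSpace ℝ (Fin d) ≃ₗᵢ[ℝ] EuclideanSpace ℝ (Fin d)) (u : L2 d) :
    compIsometry A u =ᵐ[volume] fun x => u (A x) :=
  Lp.coeFn_compMeasurePreserving u A.measurePreserving

theorem fourier_compIsometry {d : ℕ}
    (A : EuclideanSpace ℝ (Fin d) ≃ₗᵢ[ℝ] EuclideanSpace ℝ (Fin d)) (u : L2 d) :
    (𝓕 (compIsometry A u) : L2 d) = compIsometry A (𝓕 u) := by
  refine Lp.ext (ae_eq_of_integral_schwartz_mul_eq (locallyIntegrable_coe_L2 _)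
    (locallyIntegrable_coe_L2 _) fun ψ => ?_)
  have hcv : ∀ g : EuclideanSpace ℝ (Fin d) → ℂ, ∫ x, g (A x) = ∫ x, g x := fun g =>
    A.measurePreserving.integral_comp A.toHomeomorph.measurableEmbedding g
  have h1 : ∫ x, (𝓕 ψ) x * (compIsometry A u) x = ∫ x, (𝓕 ψ) x * u (A x) := by
    refine integral_congr_ae ?_
    filter_upwards [coeFn_compIsometry A u] with x hx
    rw [hx]
  have h2 : ∫ x, ψ x * (compIsometry A (𝓕 u)) x = ∫ x, ψ x * (𝓕 u : L2 d) (A x) := by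
    refine integral_congr_ae ?_
    filter_upwards [coeFn_compIsometry A (𝓕 u)] with x hx
    rw [hx]
  set χ : 𝓢(EuclideanSpace ℝ (Fin d), ℂ) :=
    SchwartzMap.compCLMOfContinuousLinearEquiv ℂ A.symm.toContinuousLinearEquiv ψ with hχ
  have hχa : ∀ x, χ x = ψ (A.symm x) := fun x => by simp [hχ]
  rw [integral_schwartz_mul_fourier, h1, h2]
  have h3 := hcv (fun x => χ x * (𝓕 u : L2 d) x)
  have h4 := hcv (fun x => (𝓕 χ) x * u x)
  simp only [hχa, LinearIsometryEquiv.symm_apply_apply] at h3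
  rw [h3]
  simp only [← hχa]
  rw [integral_schwartz_mul_fourier, ← h4]
  congr 1
  funext x
  congr 1
  rw [SchwartzMap.fourier_coe, SchwartzMap.fourier_coe, ← Real.fourier_comp_linearIsometry]
  have e1 : (χ ∘ A : EuclideanSpace ℝ (Fin d) → ℂ) = ψ := by
    funext y
    simp [hχa]
  rw [e1]

/-! ### Plancherel and interpolation of homogeneous norms -/

theorem lintegral_enorm_sq_eq {d : ℕ} (u : L2 d) : ∫⁻ x, ‖u x‖ₑ ^ 2 = ENNReal.ofReal ‖u‖ ^ 2 := by
  have h := eLpNorm_nnreal_pow_eq_lintegral (μ := (volume : Measure (EuclideanSpace ℝ (Fin d))))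
    (f := (u : EuclideanSpace ℝ (Fin d) → ℂ)) (p := 2) (by norm_num)
  simp only [NNReal.coe_ofNat, ENNReal.rpow_ofNat, ENNReal.coe_ofNat] at h
  rw [← h, Lp.norm_def, ENNReal.ofReal_toReal (Lp.eLpNorm_ne_top u)]

theorem aestronglyMeasurable_fracSymbol {d : ℕ} (s : ℝ) (u : L2 d) :
    AEStronglyMeasurable (fracSymbol s u) volume :=
  AEStronglyMeasurable.mul
    (Complex.measurable_ofReal.comp (measurable_norm.pow_const s)).aestronglyMeasurable
    (Lp.aestronglyMeasurable _)

theorem lintegral_enorm_fracSymbol {d : ℕ} {s S : ℝ} (hs : 0 ≤ s) (hsS : s ≤ S) {φ : L2 d}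
    (hφ : φ ∈ sobolevH d S) :
    ∫⁻ ξ, ‖fracSymbol s φ ξ‖ₑ ^ 2 = ENNReal.ofReal ‖fracDeriv s φ‖ ^ 2 := by
  rw [← Lp.norm_fourier_eq (fracDeriv s φ), ← lintegral_enorm_sq_eq]
  refine lintegral_congr_ae ?_
  filter_upwards [fourier_fracDeriv hs hsS hφ] with ξ hξ
  rw [hξ, fracSymbol]

theorem fracSymbol_fracDeriv {d : ℕ} {r s S : ℝ} (hr : 0 ≤ r) (hs : 0 ≤ s) (hrS : r ≤ S) {φ : L2 d}
    (hφ : φ ∈ sobolevH d S) :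
    fracSymbol s (fracDeriv r φ) =ᵐ[volume] fracSymbol (r + s) φ := by
  filter_upwards [fourier_fracDeriv hr hrS hφ] with ξ hξ
  rw [fracSymbol, hξ, fracSymbol, Real.rpow_add_of_nonneg (norm_nonneg _) hr hs]
  push_cast
  ring

/-- Interpolation of homogeneous Sobolev norms. -/
theorem norm_fracDeriv_le_interpolation {d : ℕ} {s S : ℝ} (hs : 0 ≤ s) (hsS : s ≤ S) (hS : 0 < S)
    {φ : L2 d} (hφ : φ ∈ sobolevH d S) :
    ‖fracDeriv s φ‖ ≤ ‖φ‖ ^ (1 - s / S) * ‖fracDeriv S φ‖ ^ (s / S) := by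
  have h0 : 0 ≤ s / S := by positivity
  have h1 : 0 ≤ 1 - s / S := by
    have := (div_le_one hS).mpr hsS
    linarith
  -- Hölder applied to `|φ̂|²` and `|ξ|^(2S) |φ̂|²` with weights `1 - s/S` and `s/S`; the product of
  -- the powers is `|ξ|^(2s) |φ̂|²`.
  have key := ENNReal.lintegral_mul_norm_pow_le
    (μ := (volume : Measure (EuclideanSpace ℝ (Fin d))))
    (f := fun ξ => ‖(𝓕 φ : L2 d) ξ‖ₑ ^ 2) (g := fun ξ => ‖fracSymbol S φ ξ‖ₑ ^ 2)
    ((Lp.aestronglyMeasurable _).enorm.pow_const 2)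
    ((aestronglyMeasurable_fracSymbol S φ).enorm.pow_const 2) h1 h0 (by ring)
  rw [lintegral_enorm_sq_eq, lintegral_enorm_fracSymbol hS.le le_rfl hφ, Lp.norm_fourier_eq] at key
  have hpt : ∀ ξ, (‖(𝓕 φ : L2 d) ξ‖ₑ ^ 2) ^ (1 - s / S) * (‖fracSymbol S φ ξ‖ₑ ^ 2) ^ (s / S)
      = ‖fracSymbol s φ ξ‖ₑ ^ 2 := by
    intro ξ
    have e1 : ∀ t : ℝ, 0 ≤ t → ∀ z : ℂ, (‖z‖ₑ ^ 2) ^ t = ENNReal.ofReal ((‖z‖ ^ t) ^ 2) := by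
      intro t ht z
      rw [← ofReal_norm, ← ENNReal.ofReal_pow (norm_nonneg _),
        ENNReal.ofReal_rpow_of_nonneg (by positivity) ht, ← Real.rpow_natCast, ← Real.rpow_natCast,
        ← Real.rpow_mul (norm_nonneg _), ← Real.rpow_mul (norm_nonneg _), mul_comm]
    rw [e1 _ h1, e1 _ h0, ← ENNReal.ofReal_mul (by positivity), ← ofReal_norm,
      ← ENNReal.ofReal_pow (norm_nonneg _), ← mul_pow]
    congr 2
    rw [fracSymbol, fracSymbol, norm_mul, norm_mul, Complex.norm_real, Complex.norm_real,
      Real.norm_of_nonneg (by positivity), Real.norm_of_nonneg (by positivity),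
      Real.mul_rpow (by positivity) (norm_nonneg _), ← Real.rpow_mul (norm_nonneg _),
      mul_div_cancel₀ _ hS.ne', mul_left_comm, ← Real.rpow_add_of_nonneg (norm_nonneg _) h1 h0]
    simp
  simp only [hpt] at key
  rw [lintegral_enorm_fracSymbol hs hsS hφ, ← ENNReal.ofReal_pow (norm_nonneg _),
    ← ENNReal.ofReal_pow (norm_nonneg _), ← ENNReal.ofReal_pow (norm_nonneg _),
    ENNReal.ofReal_rpow_of_nonneg (by positivity) h1,
    ENNReal.ofReal_rpow_of_nonneg (by positivity) h0, ← ENNReal.ofReal_mul (by positivity),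
    ENNReal.ofReal_le_ofReal_iff (by positivity)] at key
  have e2 : ∀ t x : ℝ, 0 ≤ x → (x ^ 2) ^ t = (x ^ t) ^ 2 := by
    intro t x hx
    rw [← Real.rpow_natCast, ← Real.rpow_natCast, ← Real.rpow_mul hx, ← Real.rpow_mul hx, mul_comm]
  rw [e2 _ _ (norm_nonneg _), e2 _ _ (norm_nonneg _), ← mul_pow] at key
  exact le_of_sq_le_sq key (by positivity)

/-! ### Finite differences and fractional smoothness -/

/-- The `m`-th order finite difference `∑ⱼ (-1)ʲ (m choose j) u(x + j h)`. -/
def finiteDiff {E F : Type*} [AddCommGroup E] [AddCommGroup F] [Module ℝ F] (m : ℕ) (h : E)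
    (u : E → F) (x : E) : F :=
  ∑ j ∈ Finset.range (m + 1), ((-1) ^ j * (m.choose j : ℝ)) • u (x + j • h)

/-- Of the `m` factors, a power `σ` is estimated by `|t|` and the remaining `m - σ` by `2`. A
difference of order `m ≥ σ` is needed because `σ` may exceed `1`. -/
theorem norm_one_sub_exp_pow_le {σ : ℝ} (hσ : 0 ≤ σ) {m : ℕ} (hm : σ ≤ m) (t : ℝ) :
    ‖1 - Complex.exp (t * Complex.I)‖ ^ m ≤ 2 ^ m * |t| ^ σ := by
  have hb1 : ‖1 - Complex.exp (t * Complex.I)‖ ≤ 2 := by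
    refine (norm_sub_le _ _).trans ?_
    rw [Complex.norm_exp_ofReal_mul_I]
    norm_num
  have hb2 : ‖1 - Complex.exp (t * Complex.I)‖ ≤ |t| := by
    rw [norm_sub_rev, mul_comm]
    simpa using Real.norm_exp_I_mul_ofReal_sub_one_le (x := t)
  set z := ‖1 - Complex.exp (t * Complex.I)‖ with hz
  have hz0 : 0 ≤ z := norm_nonneg _
  calc z ^ m = z ^ (((m : ℝ) - σ) + σ) := by rw [← Real.rpow_natCast]; congr 1; ring
    _ = z ^ ((m : ℝ) - σ) * z ^ σ := Real.rpow_add_of_nonneg hz0 (by linarith) hσ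
    _ ≤ 2 ^ ((m : ℝ) - σ) * |t| ^ σ := by gcongr
    _ ≤ 2 ^ m * |t| ^ σ := by
        gcongr
        rw [← Real.rpow_natCast]
        exact Real.rpow_le_rpow_of_exponent_le (by norm_num) (by linarith)

/-- Finite differences of order `m ≥ σ` are controlled in `L²` by the `Ḣ^σ` seminorm. -/
theorem lintegral_finiteDiff_le {d : ℕ} {σ : ℝ} (hσ : 0 ≤ σ) {m : ℕ} (hm : σ ≤ m) (u : L2 d)
    (h : EuclideanSpace ℝ (Fin d)) :
    ∫⁻ x, ‖finiteDiff m h u x‖ₑ ^ 2 ≤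
      ENNReal.ofReal (2 ^ m * (2 * Real.pi * ‖h‖) ^ σ) ^ 2 * ∫⁻ ξ, ‖fracSymbol σ u ξ‖ₑ ^ 2 := by
  set w : L2 d := ∑ j ∈ Finset.range (m + 1), (((-1) ^ j * (m.choose j : ℝ) : ℝ) : ℂ) •
    translateL2 (j • h) u with hw
  have hwx : w =ᵐ[volume] finiteDiff m h u := by
    have h1 : ∀ᵐ x, ∀ j ∈ Finset.range (m + 1), ((((-1) ^ j * (m.choose j : ℝ) : ℝ) : ℂ) •
        translateL2 (j • h) u : L2 d) x = ((-1) ^ j * (m.choose j : ℝ)) • u (x + j • h) := by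
      refine (Finset.range (m + 1)).eventually_all.mpr fun j _ => ?_
      filter_upwards [Lp.coeFn_smul (((-1) ^ j * (m.choose j : ℝ) : ℝ) : ℂ)
        (translateL2 (j • h) u), coeFn_translate (j • h) u] with x hx1 hx2
      rw [hx1, Pi.smul_apply, hx2, Complex.real_smul, smul_eq_mul]
    filter_upwards [h1, Lp.coeFn_finsetSum (Finset.range (m + 1)) fun j =>
      (((-1) ^ j * (m.choose j : ℝ) : ℝ) : ℂ) • translateL2 (j • h) u] with x hx1 hx2
    rw [hw, hx2, Finset.sum_apply, finiteDiff]
    exact Finset.sum_congr rfl hx1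
  -- Translation by `j h` multiplies the transform by the `j`-th power of one character, so the
  -- binomial theorem collapses the sum.
  have hFw : (𝓕 w : L2 d) =ᵐ[volume] fun ξ =>
      (1 - Complex.exp (2 * Real.pi * inner ℝ h ξ * Complex.I)) ^ m * (𝓕 u : L2 d) ξ := by
    have e1 : (𝓕 w : L2 d) = ∑ j ∈ Finset.range (m + 1), (((-1) ^ j * (m.choose j : ℝ) : ℝ) : ℂ) •
        (𝓕 (translateL2 (j • h) u) : L2 d) := by
      rw [hw]
      change Lp.fourierTransformₗᵢ _ _ _ = _
      rw [map_sum]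
      simp only [map_smul]
      rfl
    have h1 : ∀ᵐ ξ, ∀ j ∈ Finset.range (m + 1), ((((-1) ^ j * (m.choose j : ℝ) : ℝ) : ℂ) •
        (𝓕 (translateL2 (j • h) u) : L2 d) : L2 d) ξ = ((-1) ^ j * (m.choose j : ℂ)) *
          (Complex.exp (2 * Real.pi * inner ℝ h ξ * Complex.I) ^ j * (𝓕 u : L2 d) ξ) := by
      refine (Finset.range (m + 1)).eventually_all.mpr fun j _ => ?_
      filter_upwards [Lp.coeFn_smul (((-1) ^ j * (m.choose j : ℝ) : ℝ) : ℂ)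
        (𝓕 (translateL2 (j • h) u) : L2 d), fourier_translate (j • h) u] with x hx1 hx2
      rw [hx1, Pi.smul_apply, hx2, smul_eq_mul, ← Complex.exp_nat_mul]
      push_cast
      congr 3
      rw [← Nat.cast_smul_eq_nsmul ℝ, real_inner_smul_left]
      push_cast
      ring
    filter_upwards [h1, Lp.coeFn_finsetSum (Finset.range (m + 1)) fun j =>
      (((-1) ^ j * (m.choose j : ℝ) : ℝ) : ℂ) • (𝓕 (translateL2 (j • h) u) : L2 d)] with x hx1 hx2
    rw [e1, hx2, Finset.sum_apply, Finset.sum_congr rfl hx1, sub_eq_neg_add, add_pow,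
      Finset.sum_mul]
    refine Finset.sum_congr rfl fun j _ => ?_
    rw [neg_pow]
    ring
  calc ∫⁻ x, ‖finiteDiff m h u x‖ₑ ^ 2 = ∫⁻ x, ‖w x‖ₑ ^ 2 := by
        refine lintegral_congr_ae ?_
        filter_upwards [hwx] with x hx
        rw [hx]
    _ = ∫⁻ ξ, ‖(𝓕 w : L2 d) ξ‖ₑ ^ 2 := by
        rw [lintegral_enorm_sq_eq, lintegral_enorm_sq_eq, Lp.norm_fourier_eq]
    _ ≤ ∫⁻ ξ, ENNReal.ofReal (2 ^ m * (2 * Real.pi * ‖h‖) ^ σ) ^ 2 * ‖fracSymbol σ u ξ‖ₑ ^ 2 := by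
        refine lintegral_mono_ae ?_
        filter_upwards [hFw] with ξ hξ
        rw [hξ, ← mul_pow]
        gcongr
        rw [← ofReal_norm, ← ofReal_norm, ← ENNReal.ofReal_mul (by positivity)]
        refine ENNReal.ofReal_le_ofReal ?_
        rw [fracSymbol, norm_mul, norm_mul, norm_pow, Complex.norm_real,
          Real.norm_of_nonneg (by positivity), ← mul_assoc]
        refine mul_le_mul_of_nonneg_right ?_ (norm_nonneg _)
        have h1 := norm_one_sub_exp_pow_le hσ hm (2 * Real.pi * inner ℝ h ξ)
        push_cast at h1
        refine h1.trans ?_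
        rw [mul_assoc (2 ^ m), ← Real.mul_rpow (by positivity) (by positivity)]
        refine mul_le_mul_of_nonneg_left (Real.rpow_le_rpow (abs_nonneg _) ?_ hσ) (by positivity)
        rw [abs_mul, abs_of_nonneg (by positivity : (0:ℝ) ≤ 2 * Real.pi), mul_assoc (2 * Real.pi)]
        refine mul_le_mul_of_nonneg_left ?_ (by positivity)
        exact abs_real_inner_le_norm h ξ
    _ = _ := by
        rw [lintegral_const_mul'']
        exact (aestronglyMeasurable_fracSymbol σ u).enorm.pow_const 2

/-! ### Testing against Gaussians -/

/-- Half of the Gaussian absorbs the power: `t^r ≤ e^(rt)` and `rt ≤ r² + t²/4 ≤ r² + (π/2) t²`. -/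
theorem rpow_mul_exp_neg_sq_le {r t : ℝ} (hr : 0 ≤ r) (ht : 0 ≤ t) :
    t ^ r * Real.exp (-Real.pi * t ^ 2) ≤ Real.exp (r ^ 2) * Real.exp (-(Real.pi / 2) * t ^ 2) := by
  have h1 : t ^ r ≤ Real.exp (r * t) := by
    calc t ^ r ≤ (Real.exp t) ^ r := by
          gcongr
          linarith [Real.add_one_le_exp t]
      _ = Real.exp (r * t) := by rw [← Real.exp_mul, mul_comm]
  calc t ^ r * Real.exp (-Real.pi * t ^ 2) ≤ Real.exp (r * t) * Real.exp (-Real.pi * t ^ 2) := by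
        gcongr
    _ ≤ _ := by
        rw [← Real.exp_add, ← Real.exp_add]
        refine Real.exp_le_exp.mpr ?_
        nlinarith [sq_nonneg (r - t / 2), Real.pi_gt_three, sq_nonneg t]

/-- The Gaussian `exp (-π |x|² / R²)`. -/
def gaussian {d : ℕ} (R : ℝ) (x : EuclideanSpace ℝ (Fin d)) : ℂ :=
  Complex.exp (-((Real.pi / R ^ 2 : ℝ) : ℂ) * ‖x‖ ^ 2)

theorem integrable_gaussian {d : ℕ} {R : ℝ} (hR : 0 < R) :
    Integrable (gaussian R : EuclideanSpace ℝ (Fin d) → ℂ) := by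
  have := GaussianFourier.integrable_cexp_neg_mul_sq_norm_add
    (V := EuclideanSpace ℝ (Fin d)) (b := ((Real.pi / R ^ 2 : ℝ) : ℂ))
    (by rw [Complex.ofReal_re]; positivity) 0 0
  refine this.congr (Filter.Eventually.of_forall fun x => ?_)
  simp [gaussian]

theorem gaussian_eq_ofReal {d : ℕ} (R : ℝ) (x : EuclideanSpace ℝ (Fin d)) :
    gaussian R x = ((Real.exp (-(Real.pi / R ^ 2) * ‖x‖ ^ 2) : ℝ) : ℂ) := by
  rw [gaussian]
  push_cast
  rfl

theorem norm_gaussian_le_one {d : ℕ} (R : ℝ) (x : EuclideanSpace ℝ (Fin d)) :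
    ‖gaussian R x‖ ≤ 1 := by
  rw [gaussian_eq_ofReal, Complex.norm_real, Real.norm_of_nonneg (by positivity)]
  refine Real.exp_le_one_iff.mpr ?_
  have : 0 ≤ Real.pi / R ^ 2 * ‖x‖ ^ 2 := by positivity
  linarith

theorem memLp_gaussian {d : ℕ} {R : ℝ} (hR : 0 < R) :
    MemLp (gaussian R : EuclideanSpace ℝ (Fin d) → ℂ) 2 volume := by
  have hm := (integrable_gaussian (d := d) hR).aestronglyMeasurable
  rw [memLp_two_iff_integrable_sq_norm hm]
  refine (integrable_gaussian hR).norm.mono' (hm.norm.pow 2) (Filter.Eventually.of_forall fun x => ?_)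
  rw [norm_pow, norm_norm]
  nlinarith [norm_gaussian_le_one R x, norm_nonneg (gaussian R x)]

theorem fourier_gaussian {d : ℕ} {R : ℝ} (hR : 0 < R) (ξ : EuclideanSpace ℝ (Fin d)) :
    𝓕 (gaussian R : EuclideanSpace ℝ (Fin d) → ℂ) ξ =
      ((R ^ d * Real.exp (-Real.pi * (R * ‖ξ‖) ^ 2) : ℝ) : ℂ) := by
  have h := fourier_gaussian_innerProductSpace (V := EuclideanSpace ℝ (Fin d))
    (b := ((Real.pi / R ^ 2 : ℝ) : ℂ)) (by rw [Complex.ofReal_re]; positivity) ξ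
  have hpi := Real.pi_ne_zero
  have e1 : (Real.pi : ℂ) / ((Real.pi / R ^ 2 : ℝ) : ℂ) = ((R ^ 2 : ℝ) : ℂ) := by
    rw [← Complex.ofReal_div]
    congr 1
    field_simp
  have e2 : (((R ^ 2 : ℝ) : ℂ)) ^ ((Module.finrank ℝ (EuclideanSpace ℝ (Fin d)) : ℂ) / 2)
      = ((R ^ d : ℝ) : ℂ) := by
    have : ((Module.finrank ℝ (EuclideanSpace ℝ (Fin d)) : ℂ) / 2) = (((d : ℝ) / 2 : ℝ) : ℂ) := by
      simp
    rw [this, ← Complex.ofReal_cpow (by positivity)]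
    congr 1
    rw [← Real.rpow_natCast, ← Real.rpow_natCast, ← Real.rpow_mul hR.le]
    congr 1
    push_cast
    ring
  have hfun : (gaussian R : EuclideanSpace ℝ (Fin d) → ℂ) =
      fun v => Complex.exp (-((Real.pi / R ^ 2 : ℝ) : ℂ) * ‖v‖ ^ 2) := rfl
  rw [hfun, h, e1, e2, Complex.ofReal_mul, Complex.ofReal_exp]
  congr 2
  have hR' : (R : ℂ) ≠ 0 := by exact_mod_cast hR.ne'
  have hpi' : (Real.pi : ℂ) ≠ 0 := by exact_mod_cast hpi
  push_cast
  field_simp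

theorem lintegral_gaussian_sq {d : ℕ} {R : ℝ} (hR : 0 < R) :
    ∫⁻ ξ : EuclideanSpace ℝ (Fin d), ENNReal.ofReal (Real.exp (-(Real.pi / 2) * (R * ‖ξ‖) ^ 2)) ^ 2
      = ENNReal.ofReal (R ^ (-(d : ℝ))) := by
  have h := GaussianFourier.integral_rexp_neg_mul_sq_norm (V := EuclideanSpace ℝ (Fin d))
    (b := Real.pi * R ^ 2) (by positivity)
  have hi : Integrable fun v : EuclideanSpace ℝ (Fin d) => Real.exp (-(Real.pi * R ^ 2) * ‖v‖ ^ 2) := by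
    have := (integrable_gaussian (d := d) (R := R⁻¹) (by positivity)).norm
    refine this.congr (Filter.Eventually.of_forall fun x => ?_)
    simp only [gaussian_eq_ofReal, Complex.norm_real, Real.norm_of_nonneg (Real.exp_pos _).le]
    simp
  have e : ∀ ξ : EuclideanSpace ℝ (Fin d),
      ENNReal.ofReal (Real.exp (-(Real.pi / 2) * (R * ‖ξ‖) ^ 2)) ^ 2 =
        ENNReal.ofReal (Real.exp (-(Real.pi * R ^ 2) * ‖ξ‖ ^ 2)) := by
    intro ξ
    rw [← ENNReal.ofReal_pow (Real.exp_pos _).le, ← Real.exp_nat_mul]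
    congr 2
    push_cast
    ring
  simp_rw [e]
  rw [← ofReal_integral_eq_lintegral_ofReal hi
    (Filter.Eventually.of_forall fun _ => (Real.exp_pos _).le), h]
  congr 1
  have : Real.pi / (Real.pi * R ^ 2) = R ^ (-2 : ℝ) := by
    rw [Real.rpow_neg hR.le, Real.rpow_two]
    field_simp
  rw [this, ← Real.rpow_mul hR.le]
  congr 1
  simp
  ring

/-- Testing `D^r φ` against a Gaussian at scale `R`. -/
theorem norm_integral_gaussian_mul_fracDeriv_le {d : ℕ} {r S : ℝ} (hr : 0 ≤ r) (hrS : r ≤ S)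
    {φ : L2 d} (hφ : φ ∈ sobolevH d S) {R : ℝ} (hR : 0 < R) :
    ‖∫ x, gaussian R x * fracDeriv r φ x‖ ≤
      Real.exp (r ^ 2) * R ^ ((d : ℝ) / 2 - r) * ‖φ‖ := by
  set G : L2 d := (memLp_gaussian hR).toLp _ with hG
  have e1 : ∫ x, gaussian R x * fracDeriv r φ x = inner ℂ G (fracDeriv r φ) := by
    rw [L2.inner_def]
    refine integral_congr_ae ?_
    filter_upwards [(memLp_gaussian (d := d) hR).coeFn_toLp] with x hx
    rw [hG, hx, gaussian_eq_ofReal, RCLike.inner_apply, Complex.conj_ofReal, mul_comm]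
  rw [e1, ← Lp.inner_fourier_eq, L2.inner_def]
  have hFG : (𝓕 G : L2 d) =ᵐ[volume] 𝓕 (gaussian R : EuclideanSpace ℝ (Fin d) → ℂ) :=
    fourier_toLp_ae_eq (integrable_gaussian hR) (memLp_gaussian hR)
  have hb : ∫⁻ ξ, ‖(inner ℂ ((𝓕 G : L2 d) ξ) ((𝓕 (fracDeriv r φ) : L2 d) ξ) : ℂ)‖ₑ ≤
      ENNReal.ofReal (Real.exp (r ^ 2) * R ^ ((d : ℝ) / 2 - r) * ‖φ‖) := by
    calc ∫⁻ ξ, ‖(inner ℂ ((𝓕 G : L2 d) ξ) ((𝓕 (fracDeriv r φ) : L2 d) ξ) : ℂ)‖ₑ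
        ≤ ∫⁻ ξ, ENNReal.ofReal (Real.exp (r ^ 2) * R ^ ((d : ℝ) - r)) *
            (ENNReal.ofReal (Real.exp (-(Real.pi / 2) * (R * ‖ξ‖) ^ 2)) * ‖(𝓕 φ : L2 d) ξ‖ₑ) := by
          refine lintegral_mono_ae ?_
          filter_upwards [hFG, fourier_fracDeriv hr hrS hφ] with ξ h1 h2
          rw [h1, h2, fourier_gaussian hR, RCLike.inner_apply, Complex.conj_ofReal,
            ← ofReal_norm, ← ofReal_norm, ← mul_assoc, ← ENNReal.ofReal_mul (by positivity),
            ← ENNReal.ofReal_mul (by positivity)]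
          refine ENNReal.ofReal_le_ofReal ?_
          rw [norm_mul, norm_mul, Complex.norm_real, Complex.norm_real,
            Real.norm_of_nonneg (by positivity), Real.norm_of_nonneg (by positivity),
            mul_right_comm]
          refine mul_le_mul_of_nonneg_right ?_ (norm_nonneg _)
          have h3 := rpow_mul_exp_neg_sq_le hr (show 0 ≤ R * ‖ξ‖ by positivity)
          -- The multiplier is written as `R^d |ξ|^r = R^(d-r) (R|ξ|)^r`, so that the last factor is
          -- absorbed by the Gaussian in `R|ξ|`.
          have h4 : R ^ d = R ^ ((d : ℝ) - r) * R ^ r := by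
            rw [← Real.rpow_add hR, sub_add_cancel, Real.rpow_natCast]
          rw [Real.mul_rpow hR.le (norm_nonneg _)] at h3
          rw [h4]
          have h5 := mul_le_mul_of_nonneg_left h3 (show 0 ≤ R ^ ((d : ℝ) - r) by positivity)
          linarith
      _ = ENNReal.ofReal (Real.exp (r ^ 2) * R ^ ((d : ℝ) - r)) *
            ∫⁻ ξ, ENNReal.ofReal (Real.exp (-(Real.pi / 2) * (R * ‖ξ‖) ^ 2)) * ‖(𝓕 φ : L2 d) ξ‖ₑ := by
          rw [lintegral_const_mul' _ _ ENNReal.ofReal_ne_top]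
      -- Cauchy–Schwarz: the remaining Gaussian has `L²` norm `R^(-d/2)`, which lowers the exponent
      -- `d - r` to `d/2 - r`.
      _ ≤ ENNReal.ofReal (Real.exp (r ^ 2) * R ^ ((d : ℝ) - r)) *
            (ENNReal.ofReal (R ^ (-(d : ℝ) / 2)) * ENNReal.ofReal ‖φ‖) := by
          gcongr
          refine (ENNReal.lintegral_mul_le_Lp_mul_Lq volume Real.HolderConjugate.two_two
            (by fun_prop) (Lp.aestronglyMeasurable _).enorm).trans (le_of_eq ?_)
          simp only [ENNReal.rpow_ofNat]
          rw [lintegral_gaussian_sq hR, lintegral_enorm_sq_eq, Lp.norm_fourier_eq,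
            ENNReal.ofReal_rpow_of_nonneg (by positivity) (by norm_num), ← Real.rpow_mul hR.le,
            ← ENNReal.rpow_natCast, ← ENNReal.rpow_mul]
          congr 2
          · congr 1
            ring
          · simp
      _ = _ := by
          rw [← ENNReal.ofReal_mul (by positivity), ← ENNReal.ofReal_mul (by positivity)]
          congr 1
          rw [← mul_assoc, mul_assoc (Real.exp _), ← Real.rpow_add hR]
          congr 3
          ring
  rw [← ENNReal.ofReal_le_ofReal_iff (by positivity), ofReal_norm]
  exact (enorm_integral_le_lintegral_enorm _).trans hb

/-! ### The critical Sobolev inequality by frequency splitting -/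

theorem setLIntegral_ball_rpow {d : ℕ} {σ N : ℝ} (hσ : 0 < σ) (hσd : σ < (d : ℝ) / 2) (hN : 0 < N) :
    ∫⁻ ξ in Metric.ball (0 : EuclideanSpace ℝ (Fin d)) N, ENNReal.ofReal (‖ξ‖ ^ (-σ)) ^ 2 =
      ENNReal.ofReal (N ^ ((d : ℝ) - 2 * σ) *
        ∫ ξ in Metric.ball (0 : EuclideanSpace ℝ (Fin d)) 1, ‖ξ‖ ^ (-(2 * σ))) := by
  have hd : 1 ≤ Module.finrank ℝ (EuclideanSpace ℝ (Fin d)) := by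
    rw [finrank_euclideanSpace_fin]
    have : (0 : ℝ) < d := by linarith
    exact_mod_cast this
  have hint : IntegrableOn (fun ξ : EuclideanSpace ℝ (Fin d) => ‖ξ‖ ^ (-(2 * σ)))
      (Metric.ball 0 N) :=
    integrableOn_ball_of_norm_le_rpow (C := 1) (α := 2 * σ) hd
      (by rw [finrank_euclideanSpace_fin]; linarith)
      (Filter.Eventually.of_forall fun x => by
        rw [Real.norm_of_nonneg (by positivity), one_mul])
      (measurable_norm.pow_const _).aestronglyMeasurable
  have e1 : ∀ ξ : EuclideanSpace ℝ (Fin d),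
      ENNReal.ofReal (‖ξ‖ ^ (-σ)) ^ 2 = ENNReal.ofReal (‖ξ‖ ^ (-(2 * σ))) := by
    intro ξ
    rw [← ENNReal.ofReal_pow (by positivity), ← Real.rpow_natCast, ← Real.rpow_mul (norm_nonneg _)]
    congr 2
    push_cast
    ring
  simp_rw [e1]
  rw [← ofReal_integral_eq_lintegral_ofReal hint
    (Filter.Eventually.of_forall fun _ => by positivity)]
  congr 1
  have h2 := Measure.setIntegral_comp_smul_of_pos
    (volume : Measure (EuclideanSpace ℝ (Fin d))) (fun ξ => ‖ξ‖ ^ (-(2 * σ)))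
    (Metric.ball 0 1) hN
  rw [smul_unitBall_of_pos hN, finrank_euclideanSpace_fin, smul_eq_mul] at h2
  have h3 : ∀ ξ : EuclideanSpace ℝ (Fin d),
      ‖N • ξ‖ ^ (-(2 * σ)) = N ^ (-(2 * σ)) * ‖ξ‖ ^ (-(2 * σ)) := by
    intro ξ
    rw [norm_smul, Real.norm_of_nonneg hN.le, Real.mul_rpow hN.le (norm_nonneg _)]
  simp_rw [h3] at h2
  rw [integral_const_mul] at h2
  have hNd : (N ^ d : ℝ) ≠ 0 := by positivity
  rw [sub_eq_add_neg, Real.rpow_add hN, Real.rpow_natCast, mul_assoc, h2]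
  field_simp

/-- The part of `u` with frequencies in `s` is bounded by the `L¹` norm of its transform, hence by
`t/2`. So `|u| > t` forces the other part to be at least `t/2`, and Chebyshev with Plancherel bounds
the measure of that set. -/
theorem volume_lt_norm_le_of_lowFrequency {d : ℕ} (u : L2 d) {s : Set (EuclideanSpace ℝ (Fin d))}
    (hs : MeasurableSet s) {t : ℝ} (ht : 0 < t)
    (hlow : ∫⁻ ξ in s, ‖(𝓕 u : L2 d) ξ‖ₑ ≤ ENNReal.ofReal (t / 2)) :
    volume {x | t < ‖u x‖} ≤ ENNReal.ofReal (4 / t ^ 2) * ∫⁻ ξ in sᶜ, ‖(𝓕 u : L2 d) ξ‖ₑ ^ 2 := by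
  have hm : MemLp (𝓕 u : L2 d) 2 volume := Lp.memLp _
  have h1 : MemLp (s.indicator (𝓕 u : L2 d)) 2 volume := hm.indicator hs
  have h2 : MemLp (sᶜ.indicator (𝓕 u : L2 d)) 2 volume := hm.indicator hs.compl
  have h1i : Integrable (s.indicator (𝓕 u : L2 d)) volume := by
    rw [integrable_indicator_iff hs]
    exact ⟨(Lp.aestronglyMeasurable _).restrict, hlow.trans_lt ENNReal.ofReal_lt_top⟩
  have hdec : u = 𝓕⁻ (h1.toLp _) + 𝓕⁻ (h2.toLp _) := by
    rw [← FourierTransform.fourierInv_add, ← MemLp.toLp_add h1 h2]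
    have : (𝓕 u : L2 d) = (h1.add h2).toLp _ := by
      refine Lp.ext ?_
      filter_upwards [(h1.add h2).coeFn_toLp] with ξ hξ
      rw [hξ, Set.indicator_self_add_compl]
    rw [← this, FourierTransform.fourierInv_fourier_eq]
  have hlowpt : ∀ᵐ x, ‖(𝓕⁻ (h1.toLp _) : L2 d) x‖ ≤ t / 2 := by
    filter_upwards [norm_fourierInv_toLp_le h1i h1] with x hx
    refine hx.trans ?_
    rw [integral_norm_eq_lintegral_enorm h1i.aestronglyMeasurable]
    refine ENNReal.toReal_le_of_le_ofReal (by positivity) ?_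
    simp_rw [enorm_indicator_eq_indicator_enorm]
    rwa [lintegral_indicator hs]
  have hsub : {x | t < ‖u x‖} ≤ᵐ[volume]
      {x | ENNReal.ofReal (t ^ 2 / 4) ≤ ‖(𝓕⁻ (h2.toLp _) : L2 d) x‖ₑ ^ 2} := by
    filter_upwards [hlowpt, Lp.coeFn_add (𝓕⁻ (h1.toLp _) : L2 d) (𝓕⁻ (h2.toLp _))]
      with x hx1 hx2 hx
    have hx : t < ‖u x‖ := hx
    change ENNReal.ofReal (t ^ 2 / 4) ≤ _
    rw [hdec, hx2, Pi.add_apply] at hx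
    have h3 := norm_add_le ((𝓕⁻ (h1.toLp _) : L2 d) x) ((𝓕⁻ (h2.toLp _) : L2 d) x)
    have h4 : t / 2 ≤ ‖(𝓕⁻ (h2.toLp _) : L2 d) x‖ := by linarith
    rw [← ofReal_norm, ← ENNReal.ofReal_pow (norm_nonneg _)]
    refine ENNReal.ofReal_le_ofReal ?_
    nlinarith
  have hmk := mul_meas_ge_le_lintegral₀
    (μ := (volume : Measure (EuclideanSpace ℝ (Fin d))))
    (f := fun x => ‖(𝓕⁻ (h2.toLp _) : L2 d) x‖ₑ ^ 2)
    ((Lp.aestronglyMeasurable _).enorm.pow_const 2) (ENNReal.ofReal (t ^ 2 / 4))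
  have hP : ∫⁻ x, ‖(𝓕⁻ (h2.toLp _) : L2 d) x‖ₑ ^ 2 = ∫⁻ ξ in sᶜ, ‖(𝓕 u : L2 d) ξ‖ₑ ^ 2 := by
    rw [lintegral_enorm_sq_eq, ← Lp.norm_fourier_eq, FourierTransform.fourier_fourierInv_eq,
      ← lintegral_enorm_sq_eq, ← lintegral_indicator hs.compl]
    refine lintegral_congr_ae ?_
    filter_upwards [h2.coeFn_toLp] with ξ hξ
    rw [hξ, enorm_indicator_eq_indicator_enorm]
    by_cases h : ξ ∈ sᶜ
    · simp [Set.indicator_of_mem h]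
    · simp [Set.indicator_of_notMem h]
  rw [hP] at hmk
  refine (measure_mono_ae hsub).trans ?_
  have e : ENNReal.ofReal (4 / t ^ 2) * ENNReal.ofReal (t ^ 2 / 4) = 1 := by
    rw [← ENNReal.ofReal_mul (by positivity)]
    rw [show 4 / t ^ 2 * (t ^ 2 / 4) = 1 by field_simp, ENNReal.ofReal_one]
  calc _ = ENNReal.ofReal (4 / t ^ 2) * (ENNReal.ofReal (t ^ 2 / 4) *
        volume {x | ENNReal.ofReal (t ^ 2 / 4) ≤ ‖(𝓕⁻ (h2.toLp _) : L2 d) x‖ₑ ^ 2}) := by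
        rw [← mul_assoc, e, one_mul]
    _ ≤ _ := by gcongr

/-- Cauchy–Schwarz after writing `û = |ξ|^(-σ) · |ξ|^σ û`; the weight is square-integrable near the
origin because `2σ < d`. -/
theorem setLIntegral_ball_fourier_le {d : ℕ} {σ : ℝ} (hσ : 0 < σ) (hσd : σ < (d : ℝ) / 2) :
    ∃ K : ℝ, 0 < K ∧ ∀ (u : L2 d) (M N : ℝ), 0 ≤ M → 0 < N →
      ∫⁻ ξ, ‖fracSymbol σ u ξ‖ₑ ^ 2 = ENNReal.ofReal M ^ 2 →
      ∫⁻ ξ in Metric.ball 0 N, ‖(𝓕 u : L2 d) ξ‖ₑ ≤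
        ENNReal.ofReal (K * M * N ^ ((d : ℝ) / 2 - σ)) := by
  set J := ∫ ξ in Metric.ball (0 : EuclideanSpace ℝ (Fin d)) 1, ‖ξ‖ ^ (-(2 * σ)) with hJ
  have hJ0 : 0 ≤ J := integral_nonneg fun _ => by positivity
  -- Adding `1` makes the constant positive without showing that `J` is.
  refine ⟨J ^ (1 / 2 : ℝ) + 1, by positivity, fun u M N hM hN hu => ?_⟩
  have hd0 : 0 < d := by
    have : (0 : ℝ) < d := by linarith
    exact_mod_cast this
  have : NeZero d := ⟨hd0.ne'⟩
  have : Nontrivial (EuclideanSpace ℝ (Fin d)) := inferInstance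
  have hne : ∀ᵐ ξ : EuclideanSpace ℝ (Fin d), ξ ≠ 0 := by
    simp [ae_iff]
  calc ∫⁻ ξ in Metric.ball 0 N, ‖(𝓕 u : L2 d) ξ‖ₑ
      = ∫⁻ ξ in Metric.ball 0 N, ENNReal.ofReal (‖ξ‖ ^ (-σ)) * ‖fracSymbol σ u ξ‖ₑ := by
        refine lintegral_congr_ae (ae_restrict_of_ae ?_)
        filter_upwards [hne] with ξ hξ
        have hξ' : 0 < ‖ξ‖ := norm_pos_iff.mpr hξ
        rw [← ofReal_norm, ← ofReal_norm, ← ENNReal.ofReal_mul (by positivity), fracSymbol,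
          norm_mul, Complex.norm_real, Real.norm_of_nonneg (by positivity), ← mul_assoc,
          ← Real.rpow_add hξ', neg_add_cancel, Real.rpow_zero, one_mul]
    _ ≤ (∫⁻ ξ in Metric.ball 0 N, ENNReal.ofReal (‖ξ‖ ^ (-σ)) ^ (2 : ℝ)) ^ (1 / (2 : ℝ)) *
          (∫⁻ ξ in Metric.ball 0 N, ‖fracSymbol σ u ξ‖ₑ ^ (2 : ℝ)) ^ (1 / (2 : ℝ)) :=
        ENNReal.lintegral_mul_le_Lp_mul_Lq _ Real.HolderConjugate.two_two
          (measurable_norm.pow_const _).ennreal_ofReal.aemeasurable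
          (aestronglyMeasurable_fracSymbol σ u).enorm.restrict
    _ ≤ ENNReal.ofReal (N ^ ((d : ℝ) - 2 * σ) * J) ^ (1 / (2 : ℝ)) *
          (ENNReal.ofReal M ^ 2) ^ (1 / (2 : ℝ)) := by
        simp only [ENNReal.rpow_ofNat]
        rw [setLIntegral_ball_rpow hσ hσd hN, ← hu]
        gcongr
        exact Measure.restrict_le_self
    _ = ENNReal.ofReal (J ^ (1 / 2 : ℝ) * M * N ^ ((d : ℝ) / 2 - σ)) := by
        rw [← ENNReal.ofReal_pow hM, ENNReal.ofReal_rpow_of_nonneg (by positivity) (by norm_num),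
          ENNReal.ofReal_rpow_of_nonneg (by positivity) (by norm_num),
          ← ENNReal.ofReal_mul (by positivity)]
        congr 1
        rw [Real.mul_rpow (by positivity) hJ0, ← Real.rpow_mul hN.le, ← Real.rpow_natCast,
          ← Real.rpow_mul hM]
        have : ((d : ℝ) - 2 * σ) * (1 / 2) = (d : ℝ) / 2 - σ := by ring
        rw [this]
        norm_num
        ring
    _ ≤ _ := by
        refine ENNReal.ofReal_le_ofReal ?_
        gcongr
        linarith

theorem lintegral_Ioc_rpow {T a : ℝ} (hT : 0 ≤ T) (ha : -1 < a) :
    ∫⁻ t in Set.Ioc 0 T, ENNReal.ofReal (t ^ a) = ENNReal.ofReal (T ^ (a + 1) / (a + 1)) := by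
  have hi : IntegrableOn (fun t : ℝ => t ^ a) (Set.Ioc 0 T) :=
    (intervalIntegrable_iff_integrableOn_Ioc_of_le hT).mp (intervalIntegral.intervalIntegrable_rpow' ha)
  rw [← ofReal_integral_eq_lintegral_ofReal hi]
  · rw [← intervalIntegral.integral_of_le hT, integral_rpow (Or.inl ha), Real.zero_rpow (by linarith),
      sub_zero]
  · filter_upwards [ae_restrict_mem measurableSet_Ioc] with t ht
    exact Real.rpow_nonneg ht.1.le _

/-- The critical Sobolev inequality in `L²`-based homogeneous spaces. -/
theorem lintegral_rpow_le_sobolev {d : ℕ} {σ p : ℝ} (hσ : 0 < σ) (hσd : σ < (d : ℝ) / 2)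
    (hp : p = 2 * d / (d - 2 * σ)) :
    ∃ C : ℝ, 0 < C ∧ ∀ (u : L2 d) (M : ℝ), 0 ≤ M →
      ∫⁻ ξ, ‖fracSymbol σ u ξ‖ₑ ^ 2 = ENNReal.ofReal M ^ 2 →
      ∫⁻ x, ENNReal.ofReal (‖u x‖ ^ p) ≤ ENNReal.ofReal (C * M ^ p) := by
  obtain ⟨K, hK, hlow⟩ := setLIntegral_ball_fourier_le hσ hσd
  set q : ℝ := (d : ℝ) / 2 - σ with hq
  have hq0 : 0 < q := by rw [hq]; linarith
  have hden : 0 < (d : ℝ) - 2 * σ := by linarith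
  have hpq : q * (p - 2) = 2 * σ := by
    rw [hp, hq]
    field_simp
    ring
  have hp2 : 0 < p - 2 := by
    by_contra hcon
    nlinarith
  have hp0 : 0 < p := by linarith
  refine ⟨4 * p / (p - 2) * (2 * K) ^ (p - 2), by positivity, fun u M hM hu => ?_⟩
  -- The frequency cutoff below divides by `M`, so the case `M = 0`, where `u` vanishes, is
  -- separate.
  rcases hM.eq_or_lt with rfl | hM
  · have hu0 : u = 0 := by
      have h1 : ∫⁻ ξ, ‖fracSymbol σ u ξ‖ₑ ^ 2 = 0 := by simpa using hu
      rw [lintegral_eq_zero_iff' ((aestronglyMeasurable_fracSymbol σ u).enorm.pow_const 2)] at h1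
      have hd0 : 0 < d := by
        have : (0 : ℝ) < d := by linarith
        exact_mod_cast this
      have : NeZero d := ⟨hd0.ne'⟩
      have hne : ∀ᵐ ξ : EuclideanSpace ℝ (Fin d), ξ ≠ 0 := by simp [ae_iff]
      have h2 : (𝓕 u : L2 d) = 0 := by
        refine Lp.ext ?_
        filter_upwards [h1, hne, Lp.coeFn_zero ℂ 2 volume] with ξ h3 h4 h5
        rw [h5]
        have h6 : fracSymbol σ u ξ = 0 := by simpa using h3
        have h7 : 0 < ‖ξ‖ ^ σ := Real.rpow_pos_of_pos (norm_pos_iff.mpr h4) _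
        rw [fracSymbol, mul_eq_zero] at h6
        rcases h6 with h6 | h6
        · exact absurd (Complex.ofReal_eq_zero.mp h6) h7.ne'
        · simpa using h6
      rw [← norm_eq_zero, ← Lp.norm_fourier_eq, h2, norm_zero]
    have : ∫⁻ x, ENNReal.ofReal (‖u x‖ ^ p) = 0 := by
      rw [hu0, lintegral_eq_zero_iff' (by fun_prop)]
      filter_upwards [Lp.coeFn_zero ℂ 2 (volume : Measure (EuclideanSpace ℝ (Fin d)))] with x hx
      rw [hx]
      simp [Real.zero_rpow hp0.ne']
    rw [this]
    exact bot_le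
  -- The cutoff `N(t)` at level `t` solves `K M N^q = t/2`, which makes the low frequencies
  -- contribute at most `t/2`. Inverted, `|ξ| ≥ N(t)` means `t ≤ T ξ`.
  set T : EuclideanSpace ℝ (Fin d) → ℝ := fun ξ => 2 * K * M * ‖ξ‖ ^ q with hT
  have hT0 : ∀ ξ, 0 ≤ T ξ := fun ξ => by rw [hT]; positivity
  have hTm : Measurable T := (measurable_norm.pow_const q).const_mul _
  have hFm : Measurable fun ξ => ‖(𝓕 u : L2 d) ξ‖ₑ ^ 2 :=
    (Lp.stronglyMeasurable _).measurable.enorm.pow_const 2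
  have hTs : ∀ t, MeasurableSet {ξ | t ≤ T ξ} := fun t => measurableSet_le measurable_const hTm
  have hlevel : ∀ t : ℝ, 0 < t → volume {x | t < ‖u x‖} ≤
      ENNReal.ofReal (4 / t ^ 2) * ∫⁻ ξ, {ξ | t ≤ T ξ}.indicator (fun ξ => ‖(𝓕 u : L2 d) ξ‖ₑ ^ 2) ξ := by
    intro t ht
    have hset : {ξ | t ≤ T ξ} = (Metric.ball 0 ((t / (2 * K * M)) ^ q⁻¹))ᶜ := by
      ext ξ
      rw [Set.mem_compl_iff, mem_ball_zero_iff, not_lt, Set.mem_ofPred_eq, hT,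
        Real.rpow_inv_le_iff_of_pos (by positivity) (norm_nonneg _) hq0,
        div_le_iff₀' (by positivity)]
    rw [lintegral_indicator (hTs t), hset]
    refine volume_lt_norm_le_of_lowFrequency u measurableSet_ball ht ?_
    refine (hlow u M _ hM.le (by positivity) hu).trans (le_of_eq ?_)
    congr 1
    rw [← Real.rpow_mul (by positivity), inv_mul_cancel₀ hq0.ne', Real.rpow_one]
    field_simp
  rw [lintegral_rpow_eq_lintegral_meas_lt_mul volume (Filter.Eventually.of_forall fun _ => norm_nonneg _)
    (Lp.aestronglyMeasurable u).norm.aemeasurable hp0]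
  have hstep : ∫⁻ t in Set.Ioi (0 : ℝ), volume {x | t < ‖u x‖} * ENNReal.ofReal (t ^ (p - 1)) ≤
      ∫⁻ t in Set.Ioi (0 : ℝ), ∫⁻ ξ, {ξ | t ≤ T ξ}.indicator (fun ξ => ‖(𝓕 u : L2 d) ξ‖ₑ ^ 2) ξ *
        ENNReal.ofReal (4 * t ^ (p - 3)) := by
    refine setLIntegral_mono' measurableSet_Ioi fun t ht => ?_
    have ht : 0 < t := ht
    rw [lintegral_mul_const _ (hFm.indicator (hTs t))]
    calc _ ≤ (ENNReal.ofReal (4 / t ^ 2) *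
          ∫⁻ ξ, {ξ | t ≤ T ξ}.indicator (fun ξ => ‖(𝓕 u : L2 d) ξ‖ₑ ^ 2) ξ) *
            ENNReal.ofReal (t ^ (p - 1)) := by gcongr; exact hlevel t ht
      _ = _ := by
        rw [mul_comm (ENNReal.ofReal _), mul_assoc, ← ENNReal.ofReal_mul (by positivity)]
        congr 2
        rw [show p - 3 = (p - 1) - 2 by ring, Real.rpow_sub ht (p - 1), Real.rpow_two]
        ring
  have hswap : ∫⁻ t in Set.Ioi (0 : ℝ), ∫⁻ ξ, {ξ | t ≤ T ξ}.indicator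
        (fun ξ => ‖(𝓕 u : L2 d) ξ‖ₑ ^ 2) ξ * ENNReal.ofReal (4 * t ^ (p - 3)) =
      ∫⁻ ξ, ∫⁻ t in Set.Ioi (0 : ℝ), {ξ | t ≤ T ξ}.indicator
        (fun ξ => ‖(𝓕 u : L2 d) ξ‖ₑ ^ 2) ξ * ENNReal.ofReal (4 * t ^ (p - 3)) := by
    refine lintegral_lintegral_swap (Measurable.aemeasurable ?_)
    have hset : MeasurableSet {z : ℝ × EuclideanSpace ℝ (Fin d) | z.1 ≤ T z.2} :=
      measurableSet_le measurable_fst (hTm.comp measurable_snd)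
    have h1 : Measurable ({z : ℝ × EuclideanSpace ℝ (Fin d) | z.1 ≤ T z.2}.indicator
        fun z => ‖(𝓕 u : L2 d) z.2‖ₑ ^ 2) := (hFm.comp measurable_snd).indicator hset
    have h2 : Measurable fun z : ℝ × EuclideanSpace ℝ (Fin d) => ENNReal.ofReal (4 * z.1 ^ (p - 3)) :=
      ((measurable_fst.pow_const (p - 3)).const_mul 4).ennreal_ofReal
    exact h1.mul h2
  -- After the exchange the `t`-integral runs over `0 < t ≤ T ξ` and gives a multiple of `(T
  -- ξ)^(p-2)`, convergent at `0` since `p > 2`. The identity `q(p-2) = 2σ` turns it into a multiple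
  -- of `|ξ|^(2σ)`.
  have hinner : ∀ ξ, ∫⁻ t in Set.Ioi (0 : ℝ), {ξ | t ≤ T ξ}.indicator
        (fun ξ => ‖(𝓕 u : L2 d) ξ‖ₑ ^ 2) ξ * ENNReal.ofReal (4 * t ^ (p - 3)) =
      ENNReal.ofReal (4 / (p - 2) * (2 * K * M) ^ (p - 2)) * ‖fracSymbol σ u ξ‖ₑ ^ 2 := by
    intro ξ
    have e1 : ∀ t, {ξ | t ≤ T ξ}.indicator (fun ξ => ‖(𝓕 u : L2 d) ξ‖ₑ ^ 2) ξ *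
        ENNReal.ofReal (4 * t ^ (p - 3)) = ‖(𝓕 u : L2 d) ξ‖ₑ ^ 2 * ENNReal.ofReal 4 *
          (Set.Iic (T ξ)).indicator (fun t => ENNReal.ofReal (t ^ (p - 3))) t := by
      intro t
      by_cases h : t ≤ T ξ
      · rw [Set.indicator_of_mem (show ξ ∈ {ξ | t ≤ T ξ} from h),
          Set.indicator_of_mem (show t ∈ Set.Iic (T ξ) from h),
          ENNReal.ofReal_mul (by norm_num), mul_assoc]
      · rw [Set.indicator_of_notMem (show ξ ∉ {ξ | t ≤ T ξ} from h),
          Set.indicator_of_notMem (show t ∉ Set.Iic (T ξ) from h)]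
        simp
    simp_rw [e1]
    rw [lintegral_const_mul' _ _ (by finiteness),
      lintegral_indicator measurableSet_Iic, Measure.restrict_restrict measurableSet_Iic,
      Set.Iic_inter_Ioi, lintegral_Ioc_rpow (hT0 ξ) (by linarith), ← ofReal_norm, ← ofReal_norm,
      ← ENNReal.ofReal_pow (norm_nonneg _), ← ENNReal.ofReal_pow (norm_nonneg _),
      ← ENNReal.ofReal_mul (by positivity)]
    have e2 : p - 3 + 1 = p - 2 := by ring
    rw [← ENNReal.ofReal_mul (by positivity), ← ENNReal.ofReal_mul (by positivity), e2]
    congr 1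
    rw [hT, fracSymbol, norm_mul, Complex.norm_real, Real.norm_of_nonneg (by positivity)]
    simp only
    rw [Real.mul_rpow (by positivity) (by positivity), ← Real.rpow_mul (norm_nonneg _), hpq,
      mul_pow, ← Real.rpow_natCast (‖ξ‖ ^ σ), ← Real.rpow_mul (norm_nonneg _)]
    push_cast
    rw [mul_comm σ 2]
    ring
  calc _ ≤ ENNReal.ofReal p * ∫⁻ ξ, ENNReal.ofReal (4 / (p - 2) * (2 * K * M) ^ (p - 2)) *
        ‖fracSymbol σ u ξ‖ₑ ^ 2 := by
        gcongr
        refine hstep.trans (le_of_eq ?_)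
        rw [hswap]
        exact lintegral_congr hinner
    _ = _ := by
        rw [lintegral_const_mul' _ _ ENNReal.ofReal_ne_top, hu, ← ENNReal.ofReal_pow hM.le,
          ← ENNReal.ofReal_mul (by positivity), ← ENNReal.ofReal_mul (by positivity)]
        congr 1
        have e3 : M ^ p = M ^ (p - 2) * M ^ 2 := by
          rw [← Real.rpow_two, ← Real.rpow_add hM]
          congr 1
          ring
        rw [e3, Real.mul_rpow (by positivity) hM.le]
        ring

/-! ### Radial symmetry of `D^r φ` and its profile -/

theorem compIsometry_eq_of_isRadial {d : ℕ} {φ : L2 d} (hφ : IsRadial φ)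
    (A : EuclideanSpace ℝ (Fin d) ≃ₗᵢ[ℝ] EuclideanSpace ℝ (Fin d)) : compIsometry A φ = φ := by
  obtain ⟨f, hf⟩ := hφ
  refine Lp.ext ?_
  filter_upwards [coeFn_compIsometry A φ, hf, A.measurePreserving.quasiMeasurePreserving.ae hf]
    with x h1 h2 h3
  rw [h1, h2, h3, A.norm_map]

/-- Isometries commute with the Fourier transform and preserve the multiplier `|ξ|^r`, so the
invariance of `φ` passes to `D^r φ`. -/
theorem compIsometry_fracDeriv {d : ℕ} {r S : ℝ} (hr : 0 ≤ r) (hrS : r ≤ S) {φ : L2 d}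
    (hφ : φ ∈ sobolevH d S) (hrad : IsRadial φ)
    (A : EuclideanSpace ℝ (Fin d) ≃ₗᵢ[ℝ] EuclideanSpace ℝ (Fin d)) :
    compIsometry A (fracDeriv r φ) = fracDeriv r φ := by
  have h1 : compIsometry A (𝓕 φ : L2 d) = 𝓕 φ := by
    rw [← fourier_compIsometry, compIsometry_eq_of_isRadial hrad]
  have h2 : (𝓕 (compIsometry A (fracDeriv r φ)) : L2 d) = 𝓕 (fracDeriv r φ) := by
    rw [fourier_compIsometry]
    refine Lp.ext ?_
    have h3 := coeFn_compIsometry A (𝓕 φ : L2 d)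
    rw [h1] at h3
    have h4 := fourier_fracDeriv hr hrS hφ
    filter_upwards [coeFn_compIsometry A (𝓕 (fracDeriv r φ) : L2 d), h3, h4,
      A.measurePreserving.quasiMeasurePreserving.ae h4] with x k1 k2 k3 k4
    rw [k1, k4, k3, k2, A.norm_map]
  exact (Lp.fourierTransformₗᵢ _ _).injective h2

theorem exists_linearIsometryEquiv_map_eq {d : ℕ} {x y : EuclideanSpace ℝ (Fin d)}
    (h : ‖x‖ = ‖y‖) :
    ∃ A : EuclideanSpace ℝ (Fin d) ≃ₗᵢ[ℝ] EuclideanSpace ℝ (Fin d), A x = y :=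
  ⟨_, Submodule.reflection_sub h⟩

/-- An integrable function invariant under each linear isometry is a.e. a measurable function of
the norm. -/
theorem exists_profile_of_invariant {d : ℕ} (hd : 0 < d)
    {w : EuclideanSpace ℝ (Fin d) → ℝ≥0∞} (hw : Measurable w) (hfin : ∫⁻ x, w x ≠ ∞)
    (hinv : ∀ A : EuclideanSpace ℝ (Fin d) ≃ₗᵢ[ℝ] EuclideanSpace ℝ (Fin d), ∀ᵐ x, w (A x) = w x) :
    ∃ f : ℝ → ℝ≥0∞, Measurable f ∧ ∀ᵐ x, w x = f ‖x‖ := by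
  have : NeZero d := ⟨hd.ne'⟩
  obtain ⟨e, he⟩ := exists_norm_eq (EuclideanSpace ℝ (Fin d)) (zero_le_one' ℝ)
  -- The exceptional null set of `hinv` depends on `A`. Averages over small balls are invariant at
  -- every point, hence are genuine functions of the norm, and they recover `w` almost everywhere by
  -- Lebesgue differentiation.
  set a : ℕ → EuclideanSpace ℝ (Fin d) → ℝ≥0∞ := fun n x =>
    (∫⁻ y in Metric.closedBall x (1 / ((n : ℝ) + 1)), w y) /
      volume (Metric.closedBall x (1 / ((n : ℝ) + 1))) with ha
  have hainv : ∀ n (A : EuclideanSpace ℝ (Fin d) ≃ₗᵢ[ℝ] EuclideanSpace ℝ (Fin d)) x,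
      a n (A x) = a n x := by
    intro n A x
    have hpre : A ⁻¹' Metric.closedBall (A x) (1 / ((n : ℝ) + 1)) =
        Metric.closedBall x (1 / ((n : ℝ) + 1)) := by
      rw [A.preimage_closedBall, A.symm_apply_apply]
    simp only [ha]
    congr 1
    · rw [← A.measurePreserving.setLIntegral_comp_preimage measurableSet_closedBall hw, hpre]
      exact lintegral_congr_ae (ae_restrict_of_ae (hinv A))
    · rw [← A.measurePreserving.measure_preimage measurableSet_closedBall.nullMeasurableSet, hpre]
  have ham : ∀ n, Measurable (a n) := by
    intro n
    have h1 : ∀ x, a n x = (∫⁻ y, {z : EuclideanSpace ℝ (Fin d) × EuclideanSpace ℝ (Fin d) |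
        dist z.2 z.1 ≤ 1 / ((n : ℝ) + 1)}.indicator (fun z => w z.2) (x, y)) /
        volume (Metric.closedBall (0 : EuclideanSpace ℝ (Fin d)) (1 / ((n : ℝ) + 1))) := by
      intro x
      simp only [ha]
      rw [Measure.addHaar_closedBall_center, ← lintegral_indicator measurableSet_closedBall]
      rfl
    have h2 : a n = _ := funext h1
    rw [h2]
    refine Measurable.div_const ?_ _
    refine Measurable.lintegral_prod_right' (f := fun z =>
      {z : EuclideanSpace ℝ (Fin d) × EuclideanSpace ℝ (Fin d) |
        dist z.2 z.1 ≤ 1 / ((n : ℝ) + 1)}.indicator (fun z => w z.2) z) ?_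
    exact (hw.comp measurable_snd).indicator
      (measurableSet_le (measurable_snd.dist measurable_fst) measurable_const)
  -- The upper limit is defined and measurable even where the averages fail to converge; the fixed
  -- unit vector `e` represents each sphere.
  refine ⟨fun ρ => Filter.limsup (fun n => a n (ρ • e)) Filter.atTop,
    Measurable.limsup fun n => (ham n).comp (by fun_prop), ?_⟩
  have hdiff := (Besicovitch.vitaliFamily (volume : Measure (EuclideanSpace ℝ (Fin d)))).ae_tendsto_lintegral_div
    hw.aemeasurable hfin
  filter_upwards [hdiff] with x hx
  have hseq : Filter.Tendsto (fun n : ℕ => 1 / ((n : ℝ) + 1)) Filter.atTop (nhdsWithin 0 (Set.Ioi 0)) :=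
    tendsto_nhdsWithin_iff.mpr ⟨tendsto_one_div_add_atTop_nhds_zero_nat,
      Filter.Eventually.of_forall fun n => by
        change (0 : ℝ) < 1 / ((n : ℝ) + 1)
        positivity⟩
  have hlim := hx.comp ((Besicovitch.tendsto_filterAt volume x).comp hseq)
  have hlim' : Filter.Tendsto (fun n => a n x) Filter.atTop (nhds (w x)) := hlim
  obtain ⟨A, hA⟩ := exists_linearIsometryEquiv_map_eq (x := ‖x‖ • e) (y := x)
    (by rw [norm_smul, he, mul_one, norm_norm])
  have : (fun n => a n (‖x‖ • e)) = fun n => a n x := by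
    funext n
    rw [← hainv n A, hA]
  rw [this, hlim'.limsup_eq]

/-- A signed radial `D^r φ` is a.e. a unimodular constant times a nonnegative measurable function
of the norm. -/
theorem exists_profile_fracDeriv {d : ℕ} (hd : 0 < d) {r S : ℝ} (hr : 0 ≤ r) (hrS : r ≤ S)
    {φ : L2 d} (hφ : φ ∈ sobolevRadPlus d S r ∪ sobolevRadMinus d S r) :
    φ ∈ sobolevH d S ∧ ∃ (f : ℝ → ℝ) (ε : ℂ), Measurable f ∧ (∀ ρ, 0 ≤ f ρ) ∧ ‖ε‖ = 1 ∧
      ∀ᵐ x, fracDeriv r φ x = ε * f ‖x‖ := by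
  have hH : φ ∈ sobolevH d S := by rcases hφ with h | h <;> exact h.1
  have hrad : IsRadial φ := by rcases hφ with h | h <;> exact h.2.1
  refine ⟨hH, ?_⟩
  -- The square is used because only it is known to be integrable; a square root is taken at the
  -- end.
  obtain ⟨F, hFm, hF⟩ := exists_profile_of_invariant hd
    (w := fun x => ‖fracDeriv r φ x‖ₑ ^ 2)
    ((Lp.stronglyMeasurable _).measurable.enorm.pow_const 2)
    (by rw [lintegral_enorm_sq_eq]; finiteness)
    (fun A => by
      have h := coeFn_compIsometry A (fracDeriv r φ)
      rw [compIsometry_fracDeriv hr hrS hH hrad] at h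
      filter_upwards [h] with x hx
      rw [hx])
  have hsign : ∃ ε : ℂ, ‖ε‖ = 1 ∧ ∀ᵐ x, fracDeriv r φ x = ε * ‖fracDeriv r φ x‖ := by
    rcases hφ with h | h
    · refine ⟨1, by simp, ?_⟩
      filter_upwards [h.2.2] with x hx
      have e : fracDeriv r φ x = ((fracDeriv r φ x).re : ℂ) := by
        apply Complex.ext <;> simp [hx.1]
      rw [e, Complex.norm_real, Real.norm_of_nonneg hx.2, one_mul]
    · refine ⟨-1, by simp, ?_⟩
      filter_upwards [h.2.2] with x hx
      have e : fracDeriv r φ x = ((fracDeriv r φ x).re : ℂ) := by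
        apply Complex.ext <;> simp [hx.1]
      rw [e, Complex.norm_real, Real.norm_of_nonpos hx.2]
      push_cast
      ring
  obtain ⟨ε, hε, hs⟩ := hsign
  refine ⟨fun ρ => Real.sqrt (F ρ).toReal, ε, hFm.ennreal_toReal.sqrt, fun _ => Real.sqrt_nonneg _,
    hε, ?_⟩
  filter_upwards [hF, hs] with x h1 h2
  rw [← h1, ENNReal.toReal_pow, toReal_enorm, Real.sqrt_sq (norm_nonneg _), ← h2]

/-! ### Polar coordinates and integration along rays -/

/-- Integration in polar coordinates for nonnegative functions of the norm. -/
theorem lintegral_fun_norm_eq {d : ℕ} (hd : 0 < d) {f : ℝ → ℝ≥0∞} (hf : Measurable f) :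
    ∫⁻ x : EuclideanSpace ℝ (Fin d), f ‖x‖ =
      d * volume (Metric.ball (0 : EuclideanSpace ℝ (Fin d)) 1) *
        ∫⁻ ρ in Set.Ioi (0 : ℝ), ENNReal.ofReal (ρ ^ (d - 1)) * f ρ := by
  have : NeZero d := ⟨hd.ne'⟩
  set μ : Measure (EuclideanSpace ℝ (Fin d)) := volume
  calc ∫⁻ x, f ‖x‖ ∂μ
      = ∫⁻ x : ({(0)}ᶜ : Set (EuclideanSpace ℝ (Fin d))), f ‖x.1‖ ∂(μ.comap (↑)) := by
        rw [lintegral_subtype_comap (measurableSet_singleton _).compl fun x => f ‖x‖,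
          restrict_compl_singleton]
    _ = ∫⁻ x, f x.2 ∂μ.toSphere.prod (.volumeIoiPow (d - 1)) := by
        have := μ.measurePreserving_homeomorphUnitSphereProd.lintegral_comp_emb
          (Homeomorph.measurableEmbedding _) (f ∘ Subtype.val ∘ Prod.snd)
        simpa using this
    _ = μ.toSphere Set.univ * ∫⁻ x : Set.Ioi (0 : ℝ), f x ∂.volumeIoiPow (d - 1) := by
        rw [lintegral_prod _ (by fun_prop)]
        simp [mul_comm]
    _ = _ := by
        rw [Measure.volumeIoiPow, lintegral_withDensity_eq_lintegral_mul _ (by fun_prop) (by fun_prop),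
          μ.toSphere_apply_univ, finrank_euclideanSpace_fin]
        congr 1
        exact lintegral_subtype_comap measurableSet_Ioi fun ρ : ℝ =>
          ENNReal.ofReal (ρ ^ (d - 1)) * f ρ

/-- One-dimensional integrals of the profile are controlled by integrals over balls. -/
theorem exists_lintegral_profile_le {d : ℕ} (hd : 0 < d) :
    ∃ c : ℝ, 0 < c ∧ ∀ f : ℝ → ℝ≥0∞, Measurable f → ∀ R R' : ℝ, 0 < R →
      ∫⁻ ρ in Set.Ioo R R', f ρ ≤ ENNReal.ofReal (c * R ^ (-((d : ℝ) - 1))) *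
        ∫⁻ x in Metric.ball (0 : EuclideanSpace ℝ (Fin d)) R', f ‖x‖ := by
  have : NeZero d := ⟨hd.ne'⟩
  set b : ℝ := volume.real (Metric.ball (0 : EuclideanSpace ℝ (Fin d)) 1) with hb
  have hbe : volume (Metric.ball (0 : EuclideanSpace ℝ (Fin d)) 1) = ENNReal.ofReal b := by
    rw [hb, ofReal_measureReal measure_ball_lt_top.ne]
  have hb0 : 0 < b := by
    have := Metric.measure_ball_pos volume (0 : EuclideanSpace ℝ (Fin d)) one_pos
    rw [hbe] at this
    simpa using this
  have hd' : (0 : ℝ) < d := by exact_mod_cast hd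
  refine ⟨(d * b)⁻¹, by positivity, fun f hf R R' hR => ?_⟩
  have h1 : ∫⁻ x in Metric.ball (0 : EuclideanSpace ℝ (Fin d)) R', f ‖x‖ =
      ∫⁻ x : EuclideanSpace ℝ (Fin d), (Set.Iio R').indicator f ‖x‖ := by
    rw [← lintegral_indicator measurableSet_ball]
    refine lintegral_congr fun x => ?_
    simp [Set.indicator]
  rw [h1, lintegral_fun_norm_eq hd (hf.indicator measurableSet_Iio), hbe]
  calc ∫⁻ ρ in Set.Ioo R R', f ρ
      ≤ ∫⁻ ρ in Set.Ioo R R', ENNReal.ofReal (R ^ (-((d : ℝ) - 1))) *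
          (ENNReal.ofReal (ρ ^ (d - 1)) * (Set.Iio R').indicator f ρ) := by
        -- For `ρ > R` the polar weight satisfies `1 ≤ R^(-(d-1)) ρ^(d-1)`.
        refine setLIntegral_mono' measurableSet_Ioo fun ρ hρ => ?_
        rw [Set.indicator_of_mem (show ρ ∈ Set.Iio R' from hρ.2), ← mul_assoc,
          ← ENNReal.ofReal_mul (by positivity)]
        refine le_mul_of_one_le_left bot_le ?_
        rw [ENNReal.one_le_ofReal, Real.rpow_neg hR.le]
        have e : R ^ ((d : ℝ) - 1) = R ^ (d - 1) := by
          rw [← Real.rpow_natCast, Nat.cast_sub hd, Nat.cast_one]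
        rw [e, inv_mul_eq_div, one_le_div (by positivity)]
        exact pow_le_pow_left₀ hR.le hρ.1.le _
    _ ≤ ∫⁻ ρ in Set.Ioi (0 : ℝ), ENNReal.ofReal (R ^ (-((d : ℝ) - 1))) *
          (ENNReal.ofReal (ρ ^ (d - 1)) * (Set.Iio R').indicator f ρ) :=
        lintegral_mono_set fun ρ hρ => hR.trans hρ.1
    _ = _ := by
        rw [lintegral_const_mul' _ _ ENNReal.ofReal_ne_top, ← mul_assoc, ← ENNReal.ofReal_natCast,
          ← ENNReal.ofReal_mul hd'.le, ← ENNReal.ofReal_mul (by positivity)]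
        congr 2
        field_simp

/-- Along a ray making an angle with `x` bounded away from `π / 2`, the norm is an admissible
variable of integration. -/
theorem lintegral_ray_le {E : Type*} [NormedAddCommGroup E] [InnerProductSpace ℝ E] {x e : E}
    (he : ‖e‖ = 1) {c : ℝ} (hc : 0 < c) (hc1 : c ≤ 1) {R δ : ℝ} (hR : 0 < R)
    (hx : R ≤ ‖x‖) (hx2 : ‖x‖ < 2 * R) (hex : c * ‖x‖ ≤ inner ℝ e x) {m j : ℕ} (hj : 1 ≤ j)
    (hjm : j ≤ m) (hδ : δ ≤ R) (F : ℝ → ℝ≥0∞) :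
    ∫⁻ t in Set.Ioo 0 δ, F ‖x + j • t • e‖ ≤
      ENNReal.ofReal c⁻¹ * ∫⁻ ρ in Set.Ioo R ((m + 2) * R), F ρ := by
  set b : ℝ := inner ℝ e x with hb
  have hx0 : 0 < ‖x‖ := hR.trans_le hx
  have hb0 : 0 < b := lt_of_lt_of_le (by positivity) hex
  have hj0 : (1 : ℝ) ≤ j := by exact_mod_cast hj
  have hjm' : (j : ℝ) ≤ m := by exact_mod_cast hjm
  set Q : ℝ → ℝ := fun t => ‖x‖ ^ 2 + 2 * (j * t) * b + (j * t) ^ 2 with hQ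
  have hg : ∀ t, ‖x + j • t • e‖ = Real.sqrt (Q t) := by
    intro t
    rw [eq_comm, Real.sqrt_eq_iff_mul_self_eq (by
      have : Q t = ‖x + j • t • e‖ ^ 2 := by
        rw [norm_add_sq_real, ← Nat.cast_smul_eq_nsmul ℝ, smul_smul, real_inner_smul_right,
          real_inner_comm, norm_smul, he, mul_one, Real.norm_eq_abs, sq_abs]
        simp only [hQ, hb]
        ring
      rw [this]; positivity) (norm_nonneg _), ← sq, norm_add_sq_real,
      ← Nat.cast_smul_eq_nsmul ℝ, smul_smul, real_inner_smul_right, real_inner_comm, norm_smul, he,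
      mul_one, Real.norm_eq_abs, sq_abs]
    simp only [hQ, hb]
    ring
  have hQpos : ∀ t, 0 < t → ‖x‖ ^ 2 < Q t := by
    intro t ht
    have : 0 < (j * t) * b := by positivity
    simp only [hQ]
    nlinarith [sq_nonneg (j * t)]
  have hderiv : ∀ t ∈ Set.Ioo 0 δ, HasDerivWithinAt (fun t => Real.sqrt (Q t))
      ((2 * j * b + 2 * (j * t) * j) / (2 * Real.sqrt (Q t))) (Set.Ioo 0 δ) t := by
    intro t ht
    have h1 : HasDerivAt (fun t : ℝ => (j : ℝ) * t) j t := by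
      simpa using (hasDerivAt_id t).const_mul (j : ℝ)
    have h2 : HasDerivAt Q (2 * j * b + 2 * (j * t) * j) t := by
      have := (((h1.const_mul 2).mul_const b).const_add (‖x‖ ^ 2)).add (h1.pow 2)
      refine this.congr_deriv ?_
      push_cast
      ring
    exact (h2.sqrt ((by positivity : (0 : ℝ) < ‖x‖ ^ 2).trans (hQpos t ht.1)).ne').hasDerivWithinAt
  have hinj : Set.InjOn (fun t => Real.sqrt (Q t)) (Set.Ioo 0 δ) := by
    refine StrictMonoOn.injOn fun s hs t ht hst => ?_
    have hs0 : 0 < s := hs.1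
    refine Real.sqrt_lt_sqrt ((sq_nonneg _).trans (hQpos s hs.1).le) ?_
    simp only [hQ]
    have h1 : (j : ℝ) * s < j * t := by
      have : (0 : ℝ) < j := by linarith
      exact mul_lt_mul_of_pos_left hst this
    have h2 : 0 < (j : ℝ) * s := by positivity
    nlinarith
  -- The derivative of `|x + jte|` is `j(b + jt)/√Q`. Here `c√Q ≤ b + jt` because `c|x| ≤ b` and `c
  -- ≤ 1`, and `j ≥ 1` only helps.
  have hbound : ∀ t ∈ Set.Ioo 0 δ, c ≤ (2 * j * b + 2 * (j * t) * j) / (2 * Real.sqrt (Q t)) := by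
    intro t ht
    have ht0 : 0 < t := ht.1
    have hsq : 0 < Real.sqrt (Q t) :=
      Real.sqrt_pos.mpr ((by positivity : (0 : ℝ) < ‖x‖ ^ 2).trans (hQpos t ht0))
    rw [le_div_iff₀ (by positivity)]
    have h1 : c * Real.sqrt (Q t) ≤ b + j * t := by
      rw [← Real.sqrt_sq hc.le, ← Real.sqrt_mul (sq_nonneg c)]
      refine Real.sqrt_le_iff.mpr ⟨by positivity, ?_⟩
      simp only [hQ]
      have h2 : (c * ‖x‖) ^ 2 ≤ b ^ 2 := pow_le_pow_left₀ (by positivity) hex 2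
      have h3 : c ^ 2 ≤ 1 := by nlinarith
      have h4 : 0 ≤ 2 * (j * t) * b + (j * t) ^ 2 := by positivity
      nlinarith
    have h5 : 0 < b + j * t := by positivity
    nlinarith
  have himage : (fun t => Real.sqrt (Q t)) '' Set.Ioo 0 δ ⊆ Set.Ioo R ((m + 2) * R) := by
    rintro _ ⟨t, ht, rfl⟩
    have ht0 : 0 < t := ht.1
    refine ⟨?_, ?_⟩
    · refine hx.trans_lt ?_
      rw [Real.lt_sqrt hx0.le]
      exact hQpos t ht.1
    · change Real.sqrt (Q t) < _
      rw [← hg t]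
      refine (norm_add_le _ _).trans_lt ?_
      rw [← Nat.cast_smul_eq_nsmul ℝ, smul_smul, norm_smul, he, mul_one, Real.norm_of_nonneg
        (by positivity)]
      have : (j : ℝ) * t ≤ m * R := by
        gcongr
        exact ht.2.le.trans hδ
      linarith
  have hcv := lintegral_image_eq_lintegral_abs_deriv_mul measurableSet_Ioo hderiv hinj F
  calc ∫⁻ t in Set.Ioo 0 δ, F ‖x + j • t • e‖
      ≤ ∫⁻ t in Set.Ioo 0 δ, ENNReal.ofReal c⁻¹ *
          (ENNReal.ofReal |(2 * j * b + 2 * (j * t) * j) / (2 * Real.sqrt (Q t))| *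
            F (Real.sqrt (Q t))) := by
        refine setLIntegral_mono' measurableSet_Ioo fun t ht => ?_
        rw [hg t, ← mul_assoc, ← ENNReal.ofReal_mul (by positivity)]
        refine le_mul_of_one_le_left bot_le ?_
        rw [ENNReal.one_le_ofReal, inv_mul_eq_div, one_le_div hc]
        exact (hbound t ht).trans (le_abs_self _)
    _ = ENNReal.ofReal c⁻¹ * ∫⁻ ρ in (fun t => Real.sqrt (Q t)) '' Set.Ioo 0 δ, F ρ := by
        rw [lintegral_const_mul' _ _ ENNReal.ofReal_ne_top, hcv]
    _ ≤ _ := by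
        gcongr

/-! ### The `L²` bound on dyadic annuli -/

/-- Isolating the term `j = 0` and bounding each binomial coefficient by `2^m` gives `v ≤ Δv + 2^m
s`, where `s` is the sum of the shifted values. Multiplication by `v ≥ 0` and `v Δv ≤ (v² +
(Δv)²)/2` finish. The error is a product of values of `v`, so it can be controlled by mass alone. -/
theorem sq_le_finiteDiff_sq_add {E : Type*} [AddCommGroup E] {v : E → ℝ} (hv : ∀ x, 0 ≤ v x)
    (m : ℕ) (h x : E) :
    v x ^ 2 ≤ finiteDiff m h v x ^ 2 +
      2 ^ (m + 1) * (v x * ∑ j ∈ Finset.range m, v (x + (j + 1) • h)) := by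
  set s := ∑ j ∈ Finset.range m, v (x + (j + 1) • h) with hs
  have h1 : finiteDiff m h v x = (∑ j ∈ Finset.range m,
      ((-1) ^ (j + 1) * (m.choose (j + 1) : ℝ)) * v (x + (j + 1) • h)) + v x := by
    rw [finiteDiff, Finset.sum_range_succ']
    simp
  have h2 : |∑ j ∈ Finset.range m,
      ((-1) ^ (j + 1) * (m.choose (j + 1) : ℝ)) * v (x + (j + 1) • h)| ≤ 2 ^ m * s := by
    refine (Finset.abs_sum_le_sum_abs _ _).trans ?_
    rw [hs, Finset.mul_sum]
    refine Finset.sum_le_sum fun j _ => ?_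
    rw [abs_mul, abs_of_nonneg (hv _), abs_mul, abs_pow, abs_neg, abs_one, one_pow, one_mul,
      Nat.abs_cast]
    refine mul_le_mul_of_nonneg_right ?_ (hv _)
    exact_mod_cast Nat.choose_le_two_pow m (j + 1)
  have h3 := (abs_le.mp h2).1
  have h4 : v x ≤ finiteDiff m h v x + 2 ^ m * s := by linarith
  have h5 := mul_le_mul_of_nonneg_left h4 (hv x)
  rw [pow_succ (2 : ℝ) m]
  nlinarith [sq_nonneg (v x - finiteDiff m h v x)]

/-- The part of the dyadic annulus `R ≤ |x| < 2R` in a cone around `e`. -/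
def coneAnnulus {d : ℕ} (c R : ℝ) (e : EuclideanSpace ℝ (Fin d)) : Set (EuclideanSpace ℝ (Fin d)) :=
  {x | R ≤ ‖x‖ ∧ ‖x‖ < 2 * R ∧ c * ‖x‖ ≤ inner ℝ e x}

theorem measurableSet_coneAnnulus {d : ℕ} (c R : ℝ) (e : EuclideanSpace ℝ (Fin d)) :
    MeasurableSet (coneAnnulus c R e) :=
  (measurableSet_le measurable_const measurable_norm).inter
    ((measurableSet_lt measurable_norm measurable_const).inter
      (measurableSet_le (measurable_norm.const_mul c) (by fun_prop)))

/-- The pointwise inequality is averaged over the steps `h = te`, `0 < t < δ`. After Fubini,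
`lintegral_ray_le` bounds the inner integral of each shifted value by a profile integral that does
not depend on `x`, so the cross term factors. -/
theorem setLIntegral_coneAnnulus_le {d : ℕ} {c : ℝ} (hc : 0 < c) (hc1 : c ≤ 1)
    {e : EuclideanSpace ℝ (Fin d)} (he : ‖e‖ = 1) {f : ℝ → ℝ} (hf : Measurable f)
    (hf0 : ∀ ρ, 0 ≤ f ρ) {m : ℕ} {R δ : ℝ} (hR : 0 < R) (hδR : δ ≤ R) {D : ℝ≥0∞}
    (hD : ∀ h : EuclideanSpace ℝ (Fin d), ‖h‖ ≤ δ →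
      ∫⁻ x, ‖finiteDiff m h (fun x => f ‖x‖) x‖ₑ ^ 2 ≤ D) :
    ENNReal.ofReal δ * ∫⁻ x in coneAnnulus c R e, ENNReal.ofReal (f ‖x‖) ^ 2 ≤
      ENNReal.ofReal δ * D + ENNReal.ofReal (2 ^ (m + 1) * m * c⁻¹) *
        ((∫⁻ x in coneAnnulus c R e, ENNReal.ofReal (f ‖x‖)) *
          ∫⁻ ρ in Set.Ioo R ((m + 2) * R), ENNReal.ofReal (f ρ)) := by
  set A := coneAnnulus c R e with hA
  have hAm : MeasurableSet A := measurableSet_coneAnnulus c R e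
  set F : ℝ → ℝ≥0∞ := fun ρ => ENNReal.ofReal (f ρ) with hF
  have hFm : Measurable F := hf.ennreal_ofReal
  have hpt : ∀ t : ℝ, ∀ x : EuclideanSpace ℝ (Fin d), F ‖x‖ ^ 2 ≤
      ‖finiteDiff m (t • e) (fun x => f ‖x‖) x‖ₑ ^ 2 + ENNReal.ofReal (2 ^ (m + 1)) *
        (F ‖x‖ * ∑ j ∈ Finset.range m, F ‖x + (j + 1) • t • e‖) := by
    intro t x
    have h1 := sq_le_finiteDiff_sq_add (v := fun x : EuclideanSpace ℝ (Fin d) => f ‖x‖)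
      (fun x => hf0 _) m (t • e) x
    have h2 := ENNReal.ofReal_le_ofReal h1
    have hs : 0 ≤ ∑ j ∈ Finset.range m, f ‖x + (j + 1) • t • e‖ :=
      Finset.sum_nonneg fun _ _ => hf0 _
    rw [ENNReal.ofReal_add (sq_nonneg _) (mul_nonneg (by positivity) (mul_nonneg (hf0 _) hs)),
      ENNReal.ofReal_mul (by positivity), ENNReal.ofReal_mul (hf0 _),
      ENNReal.ofReal_sum_of_nonneg fun _ _ => hf0 _, ENNReal.ofReal_pow (hf0 _)] at h2
    refine h2.trans (le_of_eq ?_)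
    congr 1
    rw [← ofReal_norm, ← ENNReal.ofReal_pow (norm_nonneg _), Real.norm_eq_abs, sq_abs]
  have hmeas2 : Measurable fun z : ℝ × EuclideanSpace ℝ (Fin d) =>
      F ‖z.2‖ * ∑ j ∈ Finset.range m, F ‖z.2 + (j + 1) • z.1 • e‖ := by
    fun_prop
  have hstep : ∀ t ∈ Set.Ioo 0 δ, ∫⁻ x in A, F ‖x‖ ^ 2 ≤ D + ENNReal.ofReal (2 ^ (m + 1)) *
      ∫⁻ x in A, F ‖x‖ * ∑ j ∈ Finset.range m, F ‖x + (j + 1) • t • e‖ := by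
    intro t ht
    calc ∫⁻ x in A, F ‖x‖ ^ 2 ≤ ∫⁻ x in A, (‖finiteDiff m (t • e) (fun x => f ‖x‖) x‖ₑ ^ 2 +
          ENNReal.ofReal (2 ^ (m + 1)) *
            (F ‖x‖ * ∑ j ∈ Finset.range m, F ‖x + (j + 1) • t • e‖)) :=
          lintegral_mono fun x => hpt t x
      _ = (∫⁻ x in A, ‖finiteDiff m (t • e) (fun x => f ‖x‖) x‖ₑ ^ 2) +
          ENNReal.ofReal (2 ^ (m + 1)) *
            ∫⁻ x in A, F ‖x‖ * ∑ j ∈ Finset.range m, F ‖x + (j + 1) • t • e‖ := by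
          rw [lintegral_add_right _ (by fun_prop), lintegral_const_mul' _ _ ENNReal.ofReal_ne_top]
      _ ≤ _ := by
          gcongr
          refine (setLIntegral_le_lintegral _ _).trans (hD _ ?_)
          rw [norm_smul, he, mul_one, Real.norm_of_nonneg ht.1.le]
          exact ht.2.le
  have hvol : volume (Set.Ioo 0 δ) = ENNReal.ofReal δ := by rw [Real.volume_Ioo, sub_zero]
  calc ENNReal.ofReal δ * ∫⁻ x in A, F ‖x‖ ^ 2
      = ∫⁻ t in Set.Ioo 0 δ, ∫⁻ x in A, F ‖x‖ ^ 2 := by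
        rw [setLIntegral_const, hvol, mul_comm]
    _ ≤ ∫⁻ t in Set.Ioo 0 δ, (D + ENNReal.ofReal (2 ^ (m + 1)) *
          ∫⁻ x in A, F ‖x‖ * ∑ j ∈ Finset.range m, F ‖x + (j + 1) • t • e‖) :=
        setLIntegral_mono' measurableSet_Ioo hstep
    _ = ENNReal.ofReal δ * D + ENNReal.ofReal (2 ^ (m + 1)) *
          ∫⁻ t in Set.Ioo 0 δ, ∫⁻ x in A,
            F ‖x‖ * ∑ j ∈ Finset.range m, F ‖x + (j + 1) • t • e‖ := by
        rw [lintegral_add_left measurable_const, setLIntegral_const, hvol, mul_comm,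
          lintegral_const_mul' _ _ ENNReal.ofReal_ne_top]
    _ = ENNReal.ofReal δ * D + ENNReal.ofReal (2 ^ (m + 1)) *
          ∫⁻ x in A, ∫⁻ t in Set.Ioo 0 δ,
            F ‖x‖ * ∑ j ∈ Finset.range m, F ‖x + (j + 1) • t • e‖ := by
        rw [lintegral_lintegral_swap hmeas2.aemeasurable]
    _ ≤ ENNReal.ofReal δ * D + ENNReal.ofReal (2 ^ (m + 1)) *
          ∫⁻ x in A, F ‖x‖ * (m * (ENNReal.ofReal c⁻¹ *
            ∫⁻ ρ in Set.Ioo R ((m + 2) * R), F ρ)) := by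
        gcongr 2
        refine setLIntegral_mono' hAm fun x hx => ?_
        rw [lintegral_const_mul _ (by fun_prop)]
        gcongr
        rw [lintegral_finsetSum _ (fun j _ => by fun_prop)]
        refine (Finset.sum_le_card_nsmul _ _ (ENNReal.ofReal c⁻¹ *
            ∫⁻ ρ in Set.Ioo R ((m + 2) * R), F ρ) fun j hj => ?_).trans (le_of_eq ?_)
        -- The index `j < m` stands for the shift `j + 1`, which lies between `1` and `m`.
        · exact lintegral_ray_le he hc hc1 hR hx.1 hx.2.1 hx.2.2 (Nat.le_add_left 1 j)
            (Finset.mem_range.mp hj) hδR F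
        · rw [Finset.card_range, nsmul_eq_mul]
    _ = _ := by
        rw [lintegral_mul_const _ (by fun_prop), ENNReal.ofReal_mul (by positivity),
          ENNReal.ofReal_mul (by positivity), ENNReal.ofReal_natCast]
        ring

theorem exists_coord_sq_ge {d : ℕ} (hd : 0 < d) (x : EuclideanSpace ℝ (Fin d)) :
    ∃ i, (1 / Real.sqrt d) * ‖x‖ ≤ |x i| := by
  have : NeZero d := ⟨hd.ne'⟩
  obtain ⟨i, -, hi⟩ := Finset.exists_max_image Finset.univ (fun i => |x i|) ⟨0, Finset.mem_univ _⟩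
  refine ⟨i, ?_⟩
  have hd' : (0 : ℝ) < d := by exact_mod_cast hd
  rw [div_mul_eq_mul_div, one_mul, div_le_iff₀ (Real.sqrt_pos.mpr hd'), EuclideanSpace.norm_eq]
  refine Real.sqrt_le_iff.mpr ⟨by positivity, ?_⟩
  rw [mul_pow, Real.sq_sqrt hd'.le]
  calc ∑ j, ‖x j‖ ^ 2 ≤ ∑ _j : Fin d, |x i| ^ 2 := by
        refine Finset.sum_le_sum fun j _ => ?_
        rw [Real.norm_eq_abs]
        exact pow_le_pow_left₀ (abs_nonneg _) (hi j (Finset.mem_univ _)) 2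
    _ = _ := by
        rw [Finset.sum_const, Finset.card_univ, Fintype.card_fin, nsmul_eq_mul, mul_comm]

/-- `L²` bound on a dyadic annulus for a nonnegative radial function, in terms of its finite
differences of size `δ` and its mass. -/
theorem exists_setLIntegral_annulus_le {d : ℕ} (hd : 0 < d) (m : ℕ) :
    ∃ C : ℝ, 0 < C ∧ ∀ f : ℝ → ℝ, Measurable f → (∀ ρ, 0 ≤ f ρ) → ∀ R δ : ℝ, 0 < R → 0 < δ → δ ≤ R →
      ∀ D : ℝ≥0∞, (∀ h : EuclideanSpace ℝ (Fin d), ‖h‖ ≤ δ →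
        ∫⁻ x, ‖finiteDiff m h (fun x => f ‖x‖) x‖ₑ ^ 2 ≤ D) →
      ∫⁻ x in {x : EuclideanSpace ℝ (Fin d) | R ≤ ‖x‖ ∧ ‖x‖ < 2 * R}, ENNReal.ofReal (f ‖x‖) ^ 2 ≤
        ENNReal.ofReal C * (D + ENNReal.ofReal (δ⁻¹ * R ^ (-((d : ℝ) - 1))) *
          (∫⁻ x in Metric.ball (0 : EuclideanSpace ℝ (Fin d)) ((m + 2) * R),
            ENNReal.ofReal (f ‖x‖)) ^ 2) := by
  obtain ⟨k, hk, hprof⟩ := exists_lintegral_profile_le hd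
  have hd' : (1 : ℝ) ≤ d := by exact_mod_cast hd
  have hsd : 0 < Real.sqrt d := Real.sqrt_pos.mpr (by linarith)
  set c : ℝ := 1 / Real.sqrt d with hcdef
  have hc : 0 < c := by rw [hcdef]; positivity
  have hc1 : c ≤ 1 := by
    rw [hcdef, div_le_one hsd, Real.one_le_sqrt]
    exact hd'
  set K : ℝ := 2 ^ (m + 1) * m * c⁻¹ * k with hK
  have hK0 : 0 ≤ K := by positivity
  -- The annulus is covered by the `2d` cones around the positive and negative coordinate axes, and
  -- each costs `1 + K`.
  refine ⟨2 * d * (1 + K), by positivity, fun f hf hf0 R δ hR hδ hδR D hD => ?_⟩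
  set F : ℝ → ℝ≥0∞ := fun ρ => ENNReal.ofReal (f ρ) with hF
  have hFm : Measurable F := hf.ennreal_ofReal
  set I := ∫⁻ x in Metric.ball (0 : EuclideanSpace ℝ (Fin d)) ((m + 2) * R), F ‖x‖ with hI
  set B : ℝ≥0∞ := D + ENNReal.ofReal (δ⁻¹ * R ^ (-((d : ℝ) - 1))) * I ^ 2 with hB
  have hcone : ∀ e : EuclideanSpace ℝ (Fin d), ‖e‖ = 1 →
      ∫⁻ x in coneAnnulus c R e, F ‖x‖ ^ 2 ≤ ENNReal.ofReal (1 + K) * B := by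
    intro e he
    have h1 := setLIntegral_coneAnnulus_le hc hc1 he hf hf0 hR hδR hD
    have h2 : ∫⁻ x in coneAnnulus c R e, F ‖x‖ ≤ I := by
      refine lintegral_mono_set fun x hx => ?_
      rw [mem_ball_zero_iff]
      refine hx.2.1.trans_le ?_
      gcongr
      linarith [(Nat.cast_nonneg m : (0 : ℝ) ≤ m)]
    have h3 := hprof F hFm R ((m + 2) * R) hR
    have h4 : ENNReal.ofReal δ * ∫⁻ x in coneAnnulus c R e, F ‖x‖ ^ 2 ≤
        ENNReal.ofReal δ * (ENNReal.ofReal (1 + K) * B) := by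
      refine h1.trans ?_
      calc _ ≤ ENNReal.ofReal δ * D + ENNReal.ofReal (2 ^ (m + 1) * m * c⁻¹) *
            (I * (ENNReal.ofReal (k * R ^ (-((d : ℝ) - 1))) * I)) := by gcongr
        _ = ENNReal.ofReal δ * D + ENNReal.ofReal (δ * (K * (δ⁻¹ * R ^ (-((d : ℝ) - 1))))) * I ^ 2 := by
            have e1 : δ * (K * (δ⁻¹ * R ^ (-((d : ℝ) - 1)))) =
                2 ^ (m + 1) * m * c⁻¹ * (k * R ^ (-((d : ℝ) - 1))) := by
              rw [hK]; field_simp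
            rw [e1, ENNReal.ofReal_mul (p := 2 ^ (m + 1) * m * c⁻¹) (by positivity)]
            ring
        _ ≤ ENNReal.ofReal δ * (ENNReal.ofReal (1 + K) * D) + ENNReal.ofReal δ *
            (ENNReal.ofReal (1 + K) * (ENNReal.ofReal (δ⁻¹ * R ^ (-((d : ℝ) - 1))) * I ^ 2)) := by
            refine add_le_add ?_ ?_
            · refine mul_le_mul_right (le_mul_of_one_le_left bot_le ?_) _
              rw [ENNReal.one_le_ofReal]
              linarith
            · rw [ENNReal.ofReal_mul hδ.le, ENNReal.ofReal_mul hK0, mul_assoc, mul_assoc]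
              refine mul_le_mul_right (mul_le_mul_left (ENNReal.ofReal_le_ofReal ?_) _) _
              linarith
        _ = _ := by rw [hB]; ring
    rwa [ENNReal.mul_le_mul_iff_right (by simpa using hδ) ENNReal.ofReal_ne_top] at h4
  -- The coordinate of largest modulus is at least `‖x‖/√d`, and its sign selects the axis; this
  -- fixes `c = 1/√d`.
  have hcover : {x : EuclideanSpace ℝ (Fin d) | R ≤ ‖x‖ ∧ ‖x‖ < 2 * R} ⊆
      ⋃ i : Fin d, (coneAnnulus c R (EuclideanSpace.single i (1 : ℝ)) ∪
        coneAnnulus c R (-EuclideanSpace.single i (1 : ℝ))) := by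
    intro x hx
    obtain ⟨i, hi⟩ := exists_coord_sq_ge hd x
    rw [Set.mem_iUnion]
    refine ⟨i, ?_⟩
    rcases le_total 0 (x i) with h | h
    · left
      refine ⟨hx.1, hx.2, ?_⟩
      rw [abs_of_nonneg h] at hi
      simpa [EuclideanSpace.inner_single_left, hcdef] using hi
    · right
      refine ⟨hx.1, hx.2, ?_⟩
      rw [abs_of_nonpos h] at hi
      simpa [EuclideanSpace.inner_single_left, hcdef] using hi
  calc _ ≤ ∫⁻ x in ⋃ i : Fin d, (coneAnnulus c R (EuclideanSpace.single i (1 : ℝ)) ∪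
        coneAnnulus c R (-EuclideanSpace.single i (1 : ℝ))), F ‖x‖ ^ 2 := lintegral_mono_set hcover
    _ ≤ ∑' i : Fin d, ∫⁻ x in (coneAnnulus c R (EuclideanSpace.single i (1 : ℝ)) ∪
        coneAnnulus c R (-EuclideanSpace.single i (1 : ℝ))), F ‖x‖ ^ 2 := lintegral_iUnion_le _ _
    _ ≤ ∑' _i : Fin d, (ENNReal.ofReal (1 + K) * B + ENNReal.ofReal (1 + K) * B) := by
        refine ENNReal.tsum_le_tsum fun i => (lintegral_union_le _ _ _).trans (add_le_add ?_ ?_)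
        · exact hcone _ (by simp)
        · exact hcone _ (by simp)
    _ = _ := by
        rw [tsum_fintype, Finset.sum_const, Finset.card_univ, Fintype.card_fin, nsmul_eq_mul,
          ENNReal.ofReal_mul (by positivity), ENNReal.ofReal_mul (by positivity),
          ENNReal.ofReal_natCast, ENNReal.ofReal_ofNat]
        ring

/-! ### From mass and `L²` bounds to `L^p`: interpolation, summation, scaling -/

/-- The first term dominates when `v ≤ τ`, the second when `v ≥ τ`. The free threshold `τ` replaces
Hölder in interpolating between `L¹` and `L²`. -/
theorem rpow_le_mul_add_mul_sq {p v τ : ℝ} (hp1 : 1 ≤ p) (hp2 : p ≤ 2) (hv : 0 ≤ v) (hτ : 0 < τ) :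
    v ^ p ≤ τ ^ (p - 1) * v + τ ^ (p - 2) * v ^ 2 := by
  rcases hv.eq_or_lt with rfl | hv
  · rw [Real.zero_rpow (by linarith)]
    simp
  rcases le_total v τ with h | h
  · have h1 : v ^ p = v ^ (p - 1) * v := by
      rw [← Real.rpow_add_one hv.ne', sub_add_cancel]
    have h2 : v ^ (p - 1) ≤ τ ^ (p - 1) := Real.rpow_le_rpow hv.le h (by linarith)
    have h3 : 0 ≤ τ ^ (p - 2) * v ^ 2 := by positivity
    rw [h1]
    nlinarith
  · have h1 : v ^ p = v ^ (p - 2) * v ^ 2 := by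
      rw [← Real.rpow_two, ← Real.rpow_add hv, sub_add_cancel]
    have h2 : v ^ (p - 2) ≤ τ ^ (p - 2) := Real.rpow_le_rpow_of_nonpos hτ h (by linarith)
    have h3 : 0 ≤ τ ^ (p - 1) * v := by positivity
    rw [h1]
    nlinarith [sq_nonneg v]

theorem setLIntegral_rpow_le {α : Type*} [MeasurableSpace α] {μ : Measure α} {p τ : ℝ}
    (hp1 : 1 ≤ p) (hp2 : p ≤ 2) (hτ : 0 < τ) {v : α → ℝ} (hv : Measurable v) (hv0 : ∀ x, 0 ≤ v x)
    {a b : ℝ} (ha : 0 ≤ a) (hb : 0 ≤ b) (h1 : ∫⁻ x, ENNReal.ofReal (v x) ∂μ ≤ ENNReal.ofReal a)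
    (h2 : ∫⁻ x, ENNReal.ofReal (v x) ^ 2 ∂μ ≤ ENNReal.ofReal b) :
    ∫⁻ x, ENNReal.ofReal (v x ^ p) ∂μ ≤ ENNReal.ofReal (τ ^ (p - 1) * a + τ ^ (p - 2) * b) := by
  calc ∫⁻ x, ENNReal.ofReal (v x ^ p) ∂μ
      ≤ ∫⁻ x, (ENNReal.ofReal (τ ^ (p - 1)) * ENNReal.ofReal (v x) +
          ENNReal.ofReal (τ ^ (p - 2)) * ENNReal.ofReal (v x) ^ 2) ∂μ := by
        refine lintegral_mono fun x => ?_
        rw [← ENNReal.ofReal_pow (hv0 x), ← ENNReal.ofReal_mul (by positivity),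
          ← ENNReal.ofReal_mul (by positivity),
          ← ENNReal.ofReal_add (mul_nonneg (by positivity) (hv0 x)) (by positivity)]
        exact ENNReal.ofReal_le_ofReal (rpow_le_mul_add_mul_sq hp1 hp2 (hv0 x) hτ)
    _ = ENNReal.ofReal (τ ^ (p - 1)) * ∫⁻ x, ENNReal.ofReal (v x) ∂μ +
          ENNReal.ofReal (τ ^ (p - 2)) * ∫⁻ x, ENNReal.ofReal (v x) ^ 2 ∂μ := by
        rw [lintegral_add_left (by fun_prop), lintegral_const_mul' _ _ ENNReal.ofReal_ne_top,
          lintegral_const_mul' _ _ ENNReal.ofReal_ne_top]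
    _ ≤ ENNReal.ofReal (τ ^ (p - 1)) * ENNReal.ofReal a +
          ENNReal.ofReal (τ ^ (p - 2)) * ENNReal.ofReal b := by gcongr
    _ = _ := by
        rw [← ENNReal.ofReal_mul (by positivity), ← ENNReal.ofReal_mul (by positivity),
          ← ENNReal.ofReal_add (by positivity) (by positivity)]

/-- A nonnegative radial function in `L²` whose mass in balls and whose finite differences satisfy
scale-invariant bounds lies in `L^p` for `p` above the critical exponent. -/
theorem exists_lintegral_rpow_le_of_normalized {d : ℕ} (hd : 0 < d) {r σ p : ℝ} (hr : 1 / 2 < r)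
    (hσ : 0 < σ) (hp1 : 1 ≤ p) (hp2 : p ≤ 2)
    (hκ : 0 < (p - 1) * ((d : ℝ) / 2 - r + 2 * σ * ((2 * r - 1) / (2 * σ + 1))) - ((d : ℝ) / 2 - r))
    (m : ℕ) {C₀ C₁ C₂ : ℝ} (hC₀ : 0 ≤ C₀) (hC₁ : 0 ≤ C₁) (hC₂ : 0 ≤ C₂) :
    ∃ C : ℝ, 0 < C ∧ ∀ f : ℝ → ℝ, Measurable f → (∀ ρ, 0 ≤ f ρ) →
      (∫⁻ x : EuclideanSpace ℝ (Fin d), ENNReal.ofReal (f ‖x‖) ^ 2 ≤ ENNReal.ofReal C₀) →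
      (∀ R : ℝ, 0 < R → ∫⁻ x in Metric.ball (0 : EuclideanSpace ℝ (Fin d)) R,
        ENNReal.ofReal (f ‖x‖) ≤ ENNReal.ofReal (C₁ * R ^ ((d : ℝ) / 2 - r))) →
      (∀ h : EuclideanSpace ℝ (Fin d), ∫⁻ x, ‖finiteDiff m h (fun x => f ‖x‖) x‖ₑ ^ 2 ≤
        ENNReal.ofReal (C₂ * ‖h‖ ^ (2 * σ))) →
      ∫⁻ x : EuclideanSpace ℝ (Fin d), ENNReal.ofReal (f ‖x‖ ^ p) ≤ ENNReal.ofReal C := by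
  obtain ⟨K, hK, hann⟩ := exists_setLIntegral_annulus_le hd m
  set α : ℝ := (d : ℝ) / 2 - r with hα
  -- The choice `δ = R^(-γ)` balances `δ^(2σ)` against `δ⁻¹ R^(1-2r)`; both become `R^(-β)`.
  set γ : ℝ := (2 * r - 1) / (2 * σ + 1) with hγ
  set β : ℝ := 2 * σ * γ with hβ
  set κ : ℝ := (p - 1) * (α + β) - α with hκdef
  have hγ0 : 0 < γ := div_pos (by linarith) (by linarith)
  have hγβ : γ + β = 2 * r - 1 := by
    rw [hβ, hγ]
    field_simp
    ring
  set C₃ : ℝ := C₁ * 2 ^ α with hC₃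
  set C₄ : ℝ := K * (C₂ + (C₁ * ((m : ℝ) + 2) ^ α) ^ 2) with hC₄
  have hC₃0 : 0 ≤ C₃ := by positivity
  have hC₄0 : 0 ≤ C₄ := by positivity
  set s : ℝ := 2 ^ (-κ) with hs
  have hs0 : 0 < s := by positivity
  have hs1 : s < 1 := Real.rpow_lt_one_of_one_lt_of_neg one_lt_two (by linarith)
  have hgeo : 0 < (1 - s)⁻¹ := inv_pos.mpr (by linarith)
  refine ⟨C₁ + C₀ + (C₃ + C₄) * (1 - s)⁻¹ + 1, by positivity, fun f hf hf0 h0 h1 h2 => ?_⟩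
  have hfm : Measurable fun x : EuclideanSpace ℝ (Fin d) => f ‖x‖ := hf.comp measurable_norm
  set A : ℕ → Set (EuclideanSpace ℝ (Fin d)) := fun k =>
    {x | (2 : ℝ) ^ k ≤ ‖x‖ ∧ ‖x‖ < 2 * 2 ^ k} with hA
  have hannk : ∀ k : ℕ, ∫⁻ x in A k, ENNReal.ofReal (f ‖x‖ ^ p) ≤
      ENNReal.ofReal ((C₃ + C₄) * s ^ k) := by
    intro k
    set R : ℝ := (2 : ℝ) ^ k with hR
    have hR1 : 1 ≤ R := one_le_pow₀ one_le_two
    have hR0 : 0 < R := by positivity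
    have hmass : ∫⁻ x in A k, ENNReal.ofReal (f ‖x‖) ≤ ENNReal.ofReal (C₃ * R ^ α) := by
      calc ∫⁻ x in A k, ENNReal.ofReal (f ‖x‖)
          ≤ ∫⁻ x in Metric.ball (0 : EuclideanSpace ℝ (Fin d)) (2 * R), ENNReal.ofReal (f ‖x‖) :=
            lintegral_mono_set fun x hx => mem_ball_zero_iff.mpr hx.2
        _ ≤ _ := h1 _ (by positivity)
        _ = _ := by rw [Real.mul_rpow (by norm_num) hR0.le, hC₃, mul_assoc]
    have hsq : ∫⁻ x in A k, ENNReal.ofReal (f ‖x‖) ^ 2 ≤ ENNReal.ofReal (C₄ * R ^ (-β)) := by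
      -- Since `γ > 0` and `R ≥ 1`, the step is admissible; this is why only annuli outside the unit
      -- ball are treated this way.
      have hδ : R ^ (-γ) ≤ R :=
        (Real.rpow_le_one_of_one_le_of_nonpos hR1 (by linarith)).trans hR1
      have hδ0 : 0 < R ^ (-γ) := by positivity
      refine (hann f hf hf0 R (R ^ (-γ)) hR0 hδ0 hδ (ENNReal.ofReal (C₂ * (R ^ (-γ)) ^ (2 * σ)))
        fun h hh => (h2 h).trans (ENNReal.ofReal_le_ofReal (by gcongr))).trans ?_
      have hI := h1 (((m : ℝ) + 2) * R) (by positivity)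
      calc _ ≤ ENNReal.ofReal K * (ENNReal.ofReal (C₂ * (R ^ (-γ)) ^ (2 * σ)) +
            ENNReal.ofReal ((R ^ (-γ))⁻¹ * R ^ (-((d : ℝ) - 1))) *
              ENNReal.ofReal (C₁ * (((m : ℝ) + 2) * R) ^ α) ^ 2) := by gcongr
        _ = _ := by
          rw [← ENNReal.ofReal_pow (by positivity), ← ENNReal.ofReal_mul (by positivity),
            ← ENNReal.ofReal_add (by positivity) (by positivity), ← ENNReal.ofReal_mul hK.le]
          congr 1
          have e1 : (R ^ (-γ)) ^ (2 * σ) = R ^ (-β) := by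
            rw [← Real.rpow_mul hR0.le, hβ]
            congr 1
            ring
          have e2 : (R ^ (-γ))⁻¹ * R ^ (-((d : ℝ) - 1)) * (R ^ α) ^ 2 = R ^ (-β) := by
            rw [← Real.rpow_neg hR0.le, ← Real.rpow_natCast (R ^ α), ← Real.rpow_mul hR0.le,
              ← Real.rpow_add hR0, ← Real.rpow_add hR0]
            congr 1
            push_cast
            rw [hα]
            linarith
          rw [e1, Real.mul_rpow (by positivity) hR0.le, hC₄]
          calc _ = K * (C₂ * R ^ (-β) + (C₁ * ((m : ℝ) + 2) ^ α) ^ 2 *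
                ((R ^ (-γ))⁻¹ * R ^ (-((d : ℝ) - 1)) * (R ^ α) ^ 2)) := by ring
            _ = _ := by rw [e2]; ring
    -- With the threshold `τ = R^(-(α+β))`, the mass term and the square term both scale like
    -- `R^(-κ)`.
    have hτ0 : 0 < R ^ (-(α + β)) := by positivity
    refine (setLIntegral_rpow_le hp1 hp2 hτ0 hfm (fun x => hf0 _) (by positivity) (by positivity)
      hmass hsq).trans (le_of_eq ?_)
    congr 1
    have e3 : s ^ k = R ^ (-κ) := by
      rw [hs, hR, ← Real.rpow_natCast, ← Real.rpow_natCast, ← Real.rpow_mul (by norm_num),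
        ← Real.rpow_mul (by norm_num), mul_comm]
    have e4 : (R ^ (-(α + β))) ^ (p - 1) * R ^ α = R ^ (-κ) := by
      rw [← Real.rpow_mul hR0.le, ← Real.rpow_add hR0, hκdef]
      congr 1
      ring
    have e5 : (R ^ (-(α + β))) ^ (p - 2) * R ^ (-β) = R ^ (-κ) := by
      rw [← Real.rpow_mul hR0.le, ← Real.rpow_add hR0, hκdef]
      congr 1
      ring
    rw [e3]
    calc _ = C₃ * ((R ^ (-(α + β))) ^ (p - 1) * R ^ α) +
          C₄ * ((R ^ (-(α + β))) ^ (p - 2) * R ^ (-β)) := by ring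
      _ = _ := by rw [e4, e5]; ring
  -- Near the origin no decay is needed: the threshold `τ = 1` combines the mass of the unit ball
  -- with the global `L²` bound.
  have hball : ∫⁻ x in Metric.ball (0 : EuclideanSpace ℝ (Fin d)) 1, ENNReal.ofReal (f ‖x‖ ^ p) ≤
      ENNReal.ofReal (C₁ + C₀) := by
    have h3 := h1 1 one_pos
    rw [Real.one_rpow, mul_one] at h3
    have := setLIntegral_rpow_le hp1 hp2 one_pos hfm (fun x => hf0 _) hC₁ hC₀ h3
      ((setLIntegral_le_lintegral _ _).trans h0)
    simpa using this
  have hcover : (Set.univ : Set (EuclideanSpace ℝ (Fin d))) ⊆ Metric.ball 0 1 ∪ ⋃ k, A k := by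
    intro x _
    by_cases hx : ‖x‖ < 1
    · exact Or.inl (mem_ball_zero_iff.mpr hx)
    · right
      obtain ⟨k, hk1, hk2⟩ := exists_nat_pow_near (not_lt.mp hx) (one_lt_two (α := ℝ))
      exact Set.mem_iUnion.mpr ⟨k, hk1, by rwa [pow_succ'] at hk2⟩
  calc ∫⁻ x : EuclideanSpace ℝ (Fin d), ENNReal.ofReal (f ‖x‖ ^ p)
      ≤ ∫⁻ x in Metric.ball 0 1 ∪ ⋃ k, A k, ENNReal.ofReal (f ‖x‖ ^ p) := by
        rw [← setLIntegral_univ]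
        exact lintegral_mono_set hcover
    _ ≤ ENNReal.ofReal (C₁ + C₀) + ∑' k, ENNReal.ofReal ((C₃ + C₄) * s ^ k) := by
        refine (lintegral_union_le _ _ _).trans (add_le_add hball ?_)
        exact (MeasureTheory.lintegral_iUnion_le _ _).trans (ENNReal.tsum_le_tsum hannk)
    _ = ENNReal.ofReal (C₁ + C₀ + (C₃ + C₄) * (1 - s)⁻¹) := by
        rw [← ENNReal.ofReal_tsum_of_nonneg (fun k => by positivity)
          ((summable_geometric_of_lt_one hs0.le hs1).mul_left _), tsum_mul_left,
          tsum_geometric_of_lt_one hs0.le hs1, ← ENNReal.ofReal_add (by positivity) (by positivity)]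
    _ ≤ _ := ENNReal.ofReal_le_ofReal (by linarith)

theorem lintegral_comp_smul_of_pos {d : ℕ} {ℓ : ℝ} (hℓ : 0 < ℓ)
    (g : EuclideanSpace ℝ (Fin d) → ℝ≥0∞) :
    ∫⁻ x, g x = ENNReal.ofReal (ℓ ^ (d : ℝ)) * ∫⁻ x, g (ℓ • x) := by
  have h1 := Measure.map_addHaar_smul (volume : Measure (EuclideanSpace ℝ (Fin d))) hℓ.ne'
  have h2 : ∫⁻ x, g (ℓ • x) = ∫⁻ y, g y ∂(Measure.map (fun x => ℓ • x) volume) :=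
    (lintegral_map_equiv g (Homeomorph.smulOfNeZero ℓ hℓ.ne').toMeasurableEquiv).symm
  rw [h2, h1, lintegral_smul_measure, smul_eq_mul, ← mul_assoc, ← ENNReal.ofReal_mul (by positivity),
    finrank_euclideanSpace_fin, abs_of_pos (by positivity), Real.rpow_natCast,
    mul_inv_cancel₀ (by positivity), ENNReal.ofReal_one, one_mul]

/-- The scale-invariant form of `exists_lintegral_rpow_le_of_normalized`, with length scale `ℓ` and
amplitude `U`. -/
theorem exists_lintegral_rpow_le_of_scaled {d : ℕ} (hd : 0 < d) {r σ p : ℝ} (hr : 1 / 2 < r)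
    (hσ : 0 < σ) (hp1 : 1 ≤ p) (hp2 : p ≤ 2)
    (hκ : 0 < (p - 1) * ((d : ℝ) / 2 - r + 2 * σ * ((2 * r - 1) / (2 * σ + 1))) - ((d : ℝ) / 2 - r))
    (m : ℕ) {C₀ C₁ C₂ : ℝ} (hC₀ : 0 ≤ C₀) (hC₁ : 0 ≤ C₁) (hC₂ : 0 ≤ C₂) :
    ∃ C : ℝ, 0 < C ∧ ∀ ℓ U : ℝ, 0 < ℓ → 0 < U → ∀ f : ℝ → ℝ, Measurable f → (∀ ρ, 0 ≤ f ρ) →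
      (∫⁻ x : EuclideanSpace ℝ (Fin d), ENNReal.ofReal (f ‖x‖) ^ 2 ≤
        ENNReal.ofReal (C₀ * (ℓ ^ (d : ℝ) * U ^ 2))) →
      (∀ R : ℝ, 0 < R → ∫⁻ x in Metric.ball (0 : EuclideanSpace ℝ (Fin d)) R,
        ENNReal.ofReal (f ‖x‖) ≤
          ENNReal.ofReal (C₁ * (R / ℓ) ^ ((d : ℝ) / 2 - r) * (ℓ ^ (d : ℝ) * U))) →
      (∀ h : EuclideanSpace ℝ (Fin d), ∫⁻ x, ‖finiteDiff m h (fun x => f ‖x‖) x‖ₑ ^ 2 ≤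
        ENNReal.ofReal (C₂ * (‖h‖ / ℓ) ^ (2 * σ) * (ℓ ^ (d : ℝ) * U ^ 2))) →
      ∫⁻ x : EuclideanSpace ℝ (Fin d), ENNReal.ofReal (f ‖x‖ ^ p) ≤
        ENNReal.ofReal (C * (ℓ ^ (d : ℝ) * U ^ p)) := by
  obtain ⟨C, hC, hmain⟩ := exists_lintegral_rpow_le_of_normalized hd hr hσ hp1 hp2 hκ m hC₀ hC₁ hC₂
  refine ⟨C, hC, fun ℓ U hℓ hU f hf hf0 h0 h1 h2 => ?_⟩
  -- This rescaling by `ℓ` and `U` reduces all three hypotheses to their normalized forms.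
  set g : ℝ → ℝ := fun ρ => f (ℓ * ρ) / U with hg
  have hgm : Measurable g := (hf.comp (measurable_const_mul ℓ)).div_const U
  have hg0 : ∀ ρ, 0 ≤ g ρ := fun ρ => div_nonneg (hf0 _) hU.le
  have hfg : ∀ x : EuclideanSpace ℝ (Fin d), f ‖ℓ • x‖ = U * g ‖x‖ := by
    intro x
    rw [hg, norm_smul, Real.norm_of_nonneg hℓ.le]
    field_simp
  have hℓd : 0 < ℓ ^ (d : ℝ) := by positivity
  have hcancel : ∀ (a b : ℝ) (X : ℝ≥0∞), 0 < a → 0 < b →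
      ENNReal.ofReal a * (ENNReal.ofReal b * X) = ENNReal.ofReal (a * b) * X := by
    intro a b X ha hb
    rw [← mul_assoc, ← ENNReal.ofReal_mul ha.le]
  have hdiv : ∀ (a c : ℝ) (X : ℝ≥0∞), 0 < a → ENNReal.ofReal a * X ≤ ENNReal.ofReal (c * a) →
      X ≤ ENNReal.ofReal c := by
    intro a c X ha hX
    rw [mul_comm c a, ENNReal.ofReal_mul ha.le] at hX
    rwa [ENNReal.mul_le_mul_iff_right (by simpa using ha) ENNReal.ofReal_ne_top] at hX
  have k0 : ∫⁻ x : EuclideanSpace ℝ (Fin d), ENNReal.ofReal (g ‖x‖) ^ 2 ≤ ENNReal.ofReal C₀ := by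
    refine hdiv (ℓ ^ (d : ℝ) * U ^ 2) _ _ (by positivity) (le_trans (le_of_eq ?_) h0)
    rw [lintegral_comp_smul_of_pos hℓ fun x => ENNReal.ofReal (f ‖x‖) ^ 2]
    simp_rw [hfg, ENNReal.ofReal_mul hU.le, mul_pow]
    rw [lintegral_const_mul' _ _ (by finiteness), ← ENNReal.ofReal_pow hU.le,
      hcancel _ _ _ hℓd (by positivity)]
  have k1 : ∀ R : ℝ, 0 < R → ∫⁻ x in Metric.ball (0 : EuclideanSpace ℝ (Fin d)) R,
      ENNReal.ofReal (g ‖x‖) ≤ ENNReal.ofReal (C₁ * R ^ ((d : ℝ) / 2 - r)) := by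
    intro R hR
    have h3 := h1 (ℓ * R) (by positivity)
    rw [mul_div_cancel_left₀ _ hℓ.ne'] at h3
    refine hdiv (ℓ ^ (d : ℝ) * U) _ _ (by positivity) (le_trans (le_of_eq ?_) h3)
    rw [← lintegral_indicator measurableSet_ball, ← lintegral_indicator measurableSet_ball,
      lintegral_comp_smul_of_pos hℓ ((Metric.ball 0 (ℓ * R)).indicator _),
      ← hcancel _ _ _ hℓd hU, ← lintegral_const_mul' _ _ ENNReal.ofReal_ne_top]
    congr 1
    refine lintegral_congr fun x => ?_
    have hmem : ℓ • x ∈ Metric.ball (0 : EuclideanSpace ℝ (Fin d)) (ℓ * R) ↔ x ∈ Metric.ball 0 R := by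
      rw [mem_ball_zero_iff, mem_ball_zero_iff, norm_smul, Real.norm_of_nonneg hℓ.le,
        mul_lt_mul_iff_right₀ hℓ]
    by_cases hx : x ∈ Metric.ball (0 : EuclideanSpace ℝ (Fin d)) R
    · rw [Set.indicator_of_mem hx, Set.indicator_of_mem (hmem.mpr hx), hfg, ENNReal.ofReal_mul hU.le]
    · rw [Set.indicator_of_notMem hx, Set.indicator_of_notMem (fun h => hx (hmem.mp h)), mul_zero]
  have k2 : ∀ h : EuclideanSpace ℝ (Fin d), ∫⁻ x, ‖finiteDiff m h (fun x => g ‖x‖) x‖ₑ ^ 2 ≤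
      ENNReal.ofReal (C₂ * ‖h‖ ^ (2 * σ)) := by
    intro h
    have h3 := h2 (ℓ • h)
    rw [norm_smul, Real.norm_of_nonneg hℓ.le, mul_div_cancel_left₀ _ hℓ.ne'] at h3
    refine hdiv (ℓ ^ (d : ℝ) * U ^ 2) _ _ (by positivity) (le_trans (le_of_eq ?_) h3)
    rw [lintegral_comp_smul_of_pos hℓ fun x => ‖finiteDiff m (ℓ • h) (fun x => f ‖x‖) x‖ₑ ^ 2]
    have e1 : ∀ x : EuclideanSpace ℝ (Fin d), finiteDiff m (ℓ • h) (fun x => f ‖x‖) (ℓ • x) =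
        U * finiteDiff m h (fun x => g ‖x‖) x := by
      intro x
      rw [finiteDiff, finiteDiff, Finset.mul_sum]
      refine Finset.sum_congr rfl fun j _ => ?_
      rw [smul_comm j ℓ h, ← smul_add, hfg, smul_eq_mul, smul_eq_mul]
      ring
    simp_rw [e1, enorm_mul, mul_pow]
    rw [lintegral_const_mul' _ _ (by finiteness), ← ofReal_norm U, Real.norm_of_nonneg hU.le,
      ← ENNReal.ofReal_pow hU.le, hcancel _ _ _ hℓd (by positivity)]
  have hres := hmain g hgm hg0 k0 k1 k2
  rw [lintegral_comp_smul_of_pos hℓ fun x => ENNReal.ofReal (f ‖x‖ ^ p)]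
  simp_rw [hfg]
  have e2 : ∀ x : EuclideanSpace ℝ (Fin d), ENNReal.ofReal ((U * g ‖x‖) ^ p) =
      ENNReal.ofReal (U ^ p) * ENNReal.ofReal (g ‖x‖ ^ p) := by
    intro x
    rw [Real.mul_rpow hU.le (hg0 _), ENNReal.ofReal_mul (by positivity)]
  simp_rw [e2]
  rw [lintegral_const_mul' _ _ ENNReal.ofReal_ne_top, hcancel _ _ _ hℓd (by positivity), mul_comm C,
    ENNReal.ofReal_mul (p := ℓ ^ (d : ℝ) * U ^ p) (by positivity)]
  gcongr

/-! ### The exponents and the two ranges of `p` -/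

theorem eLpNorm_le_of_lintegral_rpow_le {d : ℕ} {p B : ℝ} (hp : 0 < p) (hB : 0 ≤ B) {u : L2 d}
    (h : ∫⁻ x, ENNReal.ofReal (‖u x‖ ^ p) ≤ ENNReal.ofReal B) :
    eLpNorm u (ENNReal.ofReal p) volume ≤ ENNReal.ofReal (B ^ (1 / p)) := by
  rw [eLpNorm_eq_lintegral_rpow_enorm_toReal (by simpa using hp) ENNReal.ofReal_ne_top,
    ENNReal.toReal_ofReal hp.le, ← ENNReal.ofReal_rpow_of_nonneg hB (by positivity)]
  gcongr
  refine le_trans (le_of_eq (lintegral_congr fun x => ?_)) h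
  rw [← ofReal_norm, ENNReal.ofReal_rpow_of_nonneg (norm_nonneg _) hp.le]

theorem lowerExponent_denominator_pos {d : ℕ} {r S : ℝ} (hr : 1 / 2 < r) (hrd : r < (d : ℝ) / 2)
    (hrS : r < S - 1 / 2) :
    0 < -((S - r) - 1 / 2) * ((d : ℝ) - 2 * r) + 2 * (S - r) * ((d : ℝ) - 1) := by
  have h1 : 0 < (S - r) - 1 / 2 := by linarith
  nlinarith [mul_pos h1 (show (0 : ℝ) < 2 * r - 1 by linarith),
    mul_pos (show (0 : ℝ) < S - r by linarith) (show (0 : ℝ) < (d : ℝ) - 1 by linarith)]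

/-- Twice the denominator minus the numerator equals `2(S-r)(2r-1)`, positive because `r > 1/2`. -/
theorem lowerExponent_lt_two {d : ℕ} {r S : ℝ} (hr : 1 / 2 < r) (hrd : r < (d : ℝ) / 2)
    (hrS : r < S - 1 / 2) : lowerExponent d r S < 2 := by
  rw [lowerExponent, div_lt_iff₀ (lowerExponent_denominator_pos hr hrd hrS)]
  nlinarith [mul_pos (show (0 : ℝ) < S - r by linarith) (show (0 : ℝ) < 2 * r - 1 by linarith)]

/-- The numerator exceeds the denominator by `(S - r + 1/2)(d - 2r)`. -/
theorem one_lt_lowerExponent {d : ℕ} {r S : ℝ} (hr : 1 / 2 < r) (hrd : r < (d : ℝ) / 2)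
    (hrS : r < S - 1 / 2) : 1 < lowerExponent d r S := by
  rw [lowerExponent, one_lt_div (lowerExponent_denominator_pos hr hrd hrS)]
  nlinarith [mul_pos (show (0 : ℝ) < S - r by linarith) (show (0 : ℝ) < (d : ℝ) - 2 * r by linarith)]

/-- This is the origin of `p₀`: multiplied by `2(S-r) + 1`, the decay rate is `p` times the
denominator of `p₀` minus its numerator. -/
theorem decayRate_pos_of_lowerExponent_lt {d : ℕ} {r S p : ℝ} (hr : 1 / 2 < r)
    (hrd : r < (d : ℝ) / 2) (hrS : r < S - 1 / 2) (hp : lowerExponent d r S < p) :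
    0 < (p - 1) * ((d : ℝ) / 2 - r + 2 * (S - r) * ((2 * r - 1) / (2 * (S - r) + 1))) -
      ((d : ℝ) / 2 - r) := by
  rw [lowerExponent, div_lt_iff₀ (lowerExponent_denominator_pos hr hrd hrS)] at hp
  have hσ : 0 < 2 * (S - r) + 1 := by linarith
  have e : (p - 1) * ((d : ℝ) / 2 - r + 2 * (S - r) * ((2 * r - 1) / (2 * (S - r) + 1))) -
      ((d : ℝ) / 2 - r) =
      (p * (-((S - r) - 1 / 2) * ((d : ℝ) - 2 * r) + 2 * (S - r) * ((d : ℝ) - 1)) -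
        ((d : ℝ) - 2 * r + 2 * (S - r) * ((d : ℝ) - 1))) / (2 * (S - r) + 1) := by
    field_simp
    ring
  rw [e]
  exact div_pos (by linarith) hσ

/-- The `L^p` bound in the range `p > 2`, by the critical Sobolev inequality and interpolation. -/
theorem exists_eLpNorm_fracDeriv_le_of_two_lt {d : ℕ} (hd : 0 < d) {r S p θ : ℝ} (hr : 0 ≤ r)
    (hrS : r < S) (hp2 : 2 < p)
    (hp : S - r < (d : ℝ) / 2 → p ≤ 2 * (d : ℝ) / ((d : ℝ) - 2 * (S - r)))
    (hθ : 1 / p = 1 / 2 + (r - θ * S) / (d : ℝ)) :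
    ∃ C : ℝ, 0 < C ∧ ∀ φ : L2 d, φ ∈ sobolevH d S →
      eLpNorm (fracDeriv r φ) (ENNReal.ofReal p) volume ≤
        ENNReal.ofReal (C * ‖φ‖ ^ (1 - θ) * ‖fracDeriv S φ‖ ^ θ) := by
  have hd' : (0 : ℝ) < d := by exact_mod_cast hd
  have hp0 : 0 < p := by linarith
  have hS : 0 < S := by linarith
  set σ : ℝ := d * (1 / 2 - 1 / p) with hσ
  have hσ0 : 0 < σ := by
    refine mul_pos hd' ?_
    rw [sub_pos]
    exact one_div_lt_one_div_of_lt two_pos hp2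
  have hσd : σ < (d : ℝ) / 2 := by
    have : 0 < (d : ℝ) * (1 / p) := by positivity
    rw [hσ]
    linarith
  have hpσ : p = 2 * d / (d - 2 * σ) := by
    have : (d : ℝ) - 2 * σ = 2 * d / p := by rw [hσ]; field_simp; ring
    rw [this]
    field_simp
  have hθS : θ * S = r + σ := by
    rw [hσ, hθ]
    field_simp
    ring
  -- The upper limit on `p` says that no more than `S` derivatives are used in total. When `S - r ≥
  -- d/2` this is automatic from `σ < d/2`.
  have hσS : σ ≤ S - r := by
    rcases lt_or_ge (S - r) ((d : ℝ) / 2) with h | h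
    · have h1 := hp h
      have h2 : 0 < (d : ℝ) - 2 * (S - r) := by linarith
      have h3 : 0 < (d : ℝ) - 2 * σ := by linarith
      rw [hpσ, div_le_div_iff_of_pos_left (by positivity) h3 h2] at h1
      linarith
    · linarith
  obtain ⟨C, hC, hsob⟩ := lintegral_rpow_le_sobolev hσ0 hσd hpσ
  refine ⟨C ^ (1 / p), by positivity, fun φ hφ => ?_⟩
  have hnorm : ∫⁻ ξ, ‖fracSymbol σ (fracDeriv r φ) ξ‖ₑ ^ 2 =
      ENNReal.ofReal ‖fracDeriv (r + σ) φ‖ ^ 2 := by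
    rw [← lintegral_enorm_fracSymbol (by linarith) (by linarith : r + σ ≤ S) hφ]
    refine lintegral_congr_ae ?_
    filter_upwards [fracSymbol_fracDeriv hr hσ0.le hrS.le hφ] with ξ hξ
    rw [hξ]
  have h1 := hsob (fracDeriv r φ) _ (norm_nonneg _) hnorm
  refine (eLpNorm_le_of_lintegral_rpow_le hp0 (by positivity) h1).trans
    (ENNReal.ofReal_le_ofReal ?_)
  rw [Real.mul_rpow hC.le (by positivity), ← Real.rpow_mul (norm_nonneg _),
    mul_one_div_cancel hp0.ne', Real.rpow_one, mul_assoc]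
  refine mul_le_mul_of_nonneg_left ?_ (by positivity)
  have h2 := norm_fracDeriv_le_interpolation (by linarith) (by linarith : r + σ ≤ S) hS hφ
  have h3 : (r + σ) / S = θ := by
    rw [← hθS, mul_div_cancel_right₀ _ hS.ne']
  rwa [h3] at h2

/-- The constant sign makes the modulus of the Gaussian pairing equal to the integral of the
Gaussian times `f`, and the Gaussian is at least `e^(-π)` on the ball of radius `R`. -/
theorem setLIntegral_ball_profile_le {d : ℕ} {r S : ℝ} (hr : 0 ≤ r) (hrS : r ≤ S) {φ : L2 d}
    (hφ : φ ∈ sobolevH d S) {f : ℝ → ℝ} {ε : ℂ} (hf0 : ∀ ρ, 0 ≤ f ρ) (hε : ‖ε‖ = 1)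
    (hfε : ∀ᵐ x, fracDeriv r φ x = ε * f ‖x‖) {R : ℝ} (hR : 0 < R) :
    ∫⁻ x in Metric.ball (0 : EuclideanSpace ℝ (Fin d)) R, ENNReal.ofReal (f ‖x‖) ≤
      ENNReal.ofReal (Real.exp Real.pi * (Real.exp (r ^ 2) * R ^ ((d : ℝ) / 2 - r) * ‖φ‖)) := by
  set G : EuclideanSpace ℝ (Fin d) → ℝ := fun x => Real.exp (-(Real.pi / R ^ 2) * ‖x‖ ^ 2) with hG
  have hGε : ∀ᵐ x, gaussian R x * fracDeriv r φ x = ε * ((G x * f ‖x‖ : ℝ) : ℂ) := by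
    filter_upwards [hfε] with x hx
    rw [hx, gaussian_eq_ofReal, Complex.ofReal_mul]
    ring
  have hGf0 : ∀ x, 0 ≤ G x * f ‖x‖ := fun x => mul_nonneg (Real.exp_pos _).le (hf0 _)
  have hint : Integrable fun x => G x * f ‖x‖ := by
    have h1 : Integrable fun x => gaussian R x * fracDeriv r φ x :=
      (memLp_gaussian hR).integrable_mul (Lp.memLp (fracDeriv r φ))
    refine h1.norm.congr ?_
    filter_upwards [hGε] with x hx
    rw [hx, norm_mul, hε, one_mul, Complex.norm_real, Real.norm_of_nonneg (hGf0 x)]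
  have hval : ∫ x, G x * f ‖x‖ ≤ Real.exp (r ^ 2) * R ^ ((d : ℝ) / 2 - r) * ‖φ‖ := by
    have h1 := norm_integral_gaussian_mul_fracDeriv_le hr hrS hφ hR
    rw [integral_congr_ae hGε, integral_const_mul, norm_mul, hε, one_mul, integral_complex_ofReal,
      Complex.norm_real] at h1
    exact (le_abs_self _).trans h1
  calc ∫⁻ x in Metric.ball (0 : EuclideanSpace ℝ (Fin d)) R, ENNReal.ofReal (f ‖x‖)
      ≤ ∫⁻ x in Metric.ball (0 : EuclideanSpace ℝ (Fin d)) R,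
          ENNReal.ofReal (Real.exp Real.pi) * ENNReal.ofReal (G x * f ‖x‖) := by
        refine setLIntegral_mono' measurableSet_ball fun x hx => ?_
        rw [mem_ball_zero_iff] at hx
        rw [← ENNReal.ofReal_mul (Real.exp_pos _).le, ← mul_assoc]
        refine ENNReal.ofReal_le_ofReal (le_mul_of_one_le_left (hf0 _) ?_)
        rw [hG, ← Real.exp_add, Real.one_le_exp_iff]
        have h1 : ‖x‖ ^ 2 ≤ R ^ 2 := pow_le_pow_left₀ (norm_nonneg _) hx.le 2
        have h2 : Real.pi / R ^ 2 * ‖x‖ ^ 2 ≤ Real.pi := by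
          rw [div_mul_eq_mul_div, div_le_iff₀ (by positivity)]
          exact mul_le_mul_of_nonneg_left h1 Real.pi_pos.le
        linarith
    _ ≤ ∫⁻ x, ENNReal.ofReal (Real.exp Real.pi) * ENNReal.ofReal (G x * f ‖x‖) :=
        setLIntegral_le_lintegral _ _
    _ = ENNReal.ofReal (Real.exp Real.pi * ∫ x, G x * f ‖x‖) := by
        rw [lintegral_const_mul' _ _ ENNReal.ofReal_ne_top,
          ← ofReal_integral_eq_lintegral_ofReal hint (Filter.Eventually.of_forall hGf0),
          ← ENNReal.ofReal_mul (Real.exp_pos _).le]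
    _ ≤ _ := by gcongr

theorem lintegral_finiteDiff_profile_le {d : ℕ} {r S : ℝ} (hr : 0 ≤ r) (hrS : r ≤ S) {φ : L2 d}
    (hφ : φ ∈ sobolevH d S) {f : ℝ → ℝ} {ε : ℂ} (hε : ‖ε‖ = 1)
    (hfε : ∀ᵐ x, fracDeriv r φ x = ε * f ‖x‖) {m : ℕ} (hm : S - r ≤ m)
    (h : EuclideanSpace ℝ (Fin d)) :
    ∫⁻ x, ‖finiteDiff m h (fun x => f ‖x‖) x‖ₑ ^ 2 ≤
      ENNReal.ofReal ((2 ^ m * (2 * Real.pi * ‖h‖) ^ (S - r) * ‖fracDeriv S φ‖) ^ 2) := by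
  have h1 : ∀ᵐ x, ∀ j ∈ Finset.range (m + 1),
      fracDeriv r φ (x + j • h) = ε * f ‖x + j • h‖ :=
    (Finset.range (m + 1)).eventually_all.mpr fun j _ =>
      (measurePreserving_add_const (j • h)).quasiMeasurePreserving.ae hfε
  have h2 : ∀ᵐ x, finiteDiff m h (fracDeriv r φ) x =
      ε * ((finiteDiff m h (fun x => f ‖x‖) x : ℝ) : ℂ) := by
    filter_upwards [h1] with x hx
    rw [finiteDiff, finiteDiff, Complex.ofReal_sum, Finset.mul_sum]
    refine Finset.sum_congr rfl fun j hj => ?_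
    rw [hx j hj, Complex.real_smul, smul_eq_mul]
    push_cast
    ring
  calc ∫⁻ x, ‖finiteDiff m h (fun x => f ‖x‖) x‖ₑ ^ 2
      = ∫⁻ x, ‖finiteDiff m h (fracDeriv r φ) x‖ₑ ^ 2 := by
        refine lintegral_congr_ae ?_
        filter_upwards [h2] with x hx
        rw [hx, ← ofReal_norm, ← ofReal_norm, norm_mul, hε, one_mul, Complex.norm_real]
    _ ≤ ENNReal.ofReal (2 ^ m * (2 * Real.pi * ‖h‖) ^ (S - r)) ^ 2 *
          ∫⁻ ξ, ‖fracSymbol (S - r) (fracDeriv r φ) ξ‖ₑ ^ 2 :=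
        lintegral_finiteDiff_le (by linarith) hm _ _
    _ = ENNReal.ofReal (2 ^ m * (2 * Real.pi * ‖h‖) ^ (S - r)) ^ 2 *
          ENNReal.ofReal ‖fracDeriv S φ‖ ^ 2 := by
        congr 1
        rw [← lintegral_enorm_fracSymbol (by linarith) le_rfl hφ]
        refine lintegral_congr_ae ?_
        filter_upwards [fracSymbol_fracDeriv hr (by linarith : 0 ≤ S - r) hrS hφ] with ξ hξ
        rw [hξ, add_sub_cancel]
    _ = _ := by
        rw [← mul_pow, ← ENNReal.ofReal_mul (by positivity), ← ENNReal.ofReal_pow (by positivity)]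

/-- The `L^p` bound in the range `p ≤ 2`, for radial functions with signed `D^r φ`. -/
theorem exists_eLpNorm_fracDeriv_le_of_le_two {d : ℕ} (hd : 0 < d) {r S p θ : ℝ} (hr : 1 / 2 < r)
    (hrd : r < (d : ℝ) / 2) (hrS : r < S - 1 / 2) (hp : lowerExponent d r S < p) (hp2 : p ≤ 2)
    (hθ : 1 / p = 1 / 2 + (r - θ * S) / (d : ℝ)) :
    ∃ C : ℝ, 0 < C ∧ ∀ φ : L2 d, φ ∈ sobolevRadPlus d S r ∪ sobolevRadMinus d S r →
      eLpNorm (fracDeriv r φ) (ENNReal.ofReal p) volume ≤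
        ENNReal.ofReal (C * ‖φ‖ ^ (1 - θ) * ‖fracDeriv S φ‖ ^ θ) := by
  have hd' : (0 : ℝ) < d := by exact_mod_cast hd
  have hp1 : 1 < p := (one_lt_lowerExponent hr hrd hrS).trans hp
  have hp0 : 0 < p := by linarith
  have hr0 : 0 ≤ r := by linarith
  have hrS' : r ≤ S := by linarith
  have hS : 0 < S := by linarith
  obtain ⟨m, hm⟩ := exists_nat_ge (S - r)
  obtain ⟨C, hC, hmain⟩ := exists_lintegral_rpow_le_of_scaled hd hr (by linarith : 0 < S - r) hp1.le
    hp2 (decayRate_pos_of_lowerExponent_lt hr hrd hrS hp) m (C₀ := 1)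
    (C₁ := Real.exp Real.pi * Real.exp (r ^ 2)) (C₂ := (2 ^ m * (2 * Real.pi) ^ (S - r)) ^ 2)
    zero_le_one (by positivity) (by positivity)
  refine ⟨C ^ (1 / p), by positivity, fun φ hφ => ?_⟩
  obtain ⟨hH, f, ε, hf, hf0, hε, hfε⟩ := exists_profile_fracDeriv hd hr0 hrS' hφ
  have hinterp := norm_fracDeriv_le_interpolation hr0 hrS' hS hH
  have hrS1 : r / S < 1 := (div_lt_one hS).mpr (by linarith)
  have hrS0 : 0 < r / S := div_pos (by linarith) hS
  -- If either norm vanishes, no length scale exists; interpolation then gives `D^r φ = 0`, since `0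
  -- < r/S < 1`.
  by_cases hzero : ‖φ‖ = 0 ∨ ‖fracDeriv S φ‖ = 0
  · have h1 : ‖fracDeriv r φ‖ ≤ 0 := by
      refine hinterp.trans (le_of_eq ?_)
      rcases hzero with h | h
      · rw [h, Real.zero_rpow (by linarith), zero_mul]
      · rw [h, Real.zero_rpow hrS0.ne', mul_zero]
    rw [norm_le_zero_iff.mp h1, eLpNorm_congr_ae (Lp.coeFn_zero ℂ 2 volume), eLpNorm_zero]
    exact bot_le
  push Not at hzero
  set a := ‖φ‖ with ha
  set b := ‖fracDeriv S φ‖ with hb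
  have ha0 : 0 < a := lt_of_le_of_ne (norm_nonneg _) hzero.1.symm
  have hb0 : 0 < b := lt_of_le_of_ne (norm_nonneg _) hzero.2.symm
  -- The scale at which `b = a ℓ^(-S)`, so that `a^(1-t) b^t = a ℓ^(-tS)` for every `t`. The
  -- amplitude `U` is then forced by the size `a ℓ^(-r)` of the `L²` norm of `D^r φ`.
  set ℓ : ℝ := (a / b) ^ (1 / S) with hℓ
  have hℓ0 : 0 < ℓ := by positivity
  set U : ℝ := a * ℓ ^ (-r - d / 2) with hU
  have hU0 : 0 < U := by positivity
  have hbℓ : b = a * ℓ ^ (-S) := by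
    rw [hℓ, ← Real.rpow_mul (by positivity)]
    have : 1 / S * -S = -1 := by field_simp
    rw [this, Real.rpow_neg_one]
    field_simp
  have hab : ∀ t : ℝ, a ^ (1 - t) * b ^ t = a * ℓ ^ (-(t * S)) := by
    intro t
    rw [hbℓ, Real.mul_rpow ha0.le (by positivity), ← mul_assoc, ← Real.rpow_add ha0,
      sub_add_cancel, Real.rpow_one, ← Real.rpow_mul hℓ0.le]
    congr 2
    ring
  have hUsq : ℓ ^ (d : ℝ) * U ^ 2 = (a * ℓ ^ (-r)) ^ 2 := by
    rw [hU, mul_pow, mul_pow, ← Real.rpow_natCast (ℓ ^ _), ← Real.rpow_natCast (ℓ ^ (-r)),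
      ← Real.rpow_mul hℓ0.le, ← Real.rpow_mul hℓ0.le, mul_left_comm, ← Real.rpow_add hℓ0]
    congr 2
    push_cast
    ring
  have hnormf : ∀ᵐ x, ‖fracDeriv r φ x‖ = f ‖x‖ := by
    filter_upwards [hfε] with x hx
    rw [hx, norm_mul, hε, one_mul, Complex.norm_real, Real.norm_of_nonneg (hf0 _)]
  have h0 : ∫⁻ x : EuclideanSpace ℝ (Fin d), ENNReal.ofReal (f ‖x‖) ^ 2 ≤
      ENNReal.ofReal (1 * (ℓ ^ (d : ℝ) * U ^ 2)) := by
    calc ∫⁻ x : EuclideanSpace ℝ (Fin d), ENNReal.ofReal (f ‖x‖) ^ 2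
        = ∫⁻ x, ‖fracDeriv r φ x‖ₑ ^ 2 := by
          refine lintegral_congr_ae ?_
          filter_upwards [hnormf] with x hx
          rw [← hx, ofReal_norm]
      _ = ENNReal.ofReal (‖fracDeriv r φ‖ ^ 2) := by
          rw [lintegral_enorm_sq_eq, ENNReal.ofReal_pow (norm_nonneg _)]
      _ ≤ _ := by
          refine ENNReal.ofReal_le_ofReal ?_
          rw [one_mul, hUsq]
          refine pow_le_pow_left₀ (norm_nonneg _) (hinterp.trans (le_of_eq ?_)) 2
          rw [hab, div_mul_cancel₀ _ hS.ne']
  have h1 : ∀ R : ℝ, 0 < R → ∫⁻ x in Metric.ball (0 : EuclideanSpace ℝ (Fin d)) R,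
      ENNReal.ofReal (f ‖x‖) ≤ ENNReal.ofReal (Real.exp Real.pi * Real.exp (r ^ 2) *
        (R / ℓ) ^ ((d : ℝ) / 2 - r) * (ℓ ^ (d : ℝ) * U)) := by
    intro R hR
    refine (setLIntegral_ball_profile_le hr0 hrS' hH hf0 hε hfε hR).trans (le_of_eq ?_)
    congr 1
    have e1 : (ℓ ^ ((d : ℝ) / 2 - r))⁻¹ * (ℓ ^ (d : ℝ) * ℓ ^ (-r - d / 2)) = 1 := by
      rw [← Real.rpow_neg hℓ0.le, ← Real.rpow_add hℓ0, ← Real.rpow_add hℓ0]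
      have : -((d : ℝ) / 2 - r) + ((d : ℝ) + (-r - d / 2)) = 0 := by ring
      rw [this, Real.rpow_zero]
    rw [Real.div_rpow hR.le hℓ0.le, hU]
    calc _ = Real.exp Real.pi * Real.exp (r ^ 2) * R ^ ((d : ℝ) / 2 - r) * a * 1 := by ring
      _ = _ := by rw [← e1]; ring
  have h2 : ∀ h : EuclideanSpace ℝ (Fin d), ∫⁻ x, ‖finiteDiff m h (fun x => f ‖x‖) x‖ₑ ^ 2 ≤
      ENNReal.ofReal ((2 ^ m * (2 * Real.pi) ^ (S - r)) ^ 2 * (‖h‖ / ℓ) ^ (2 * (S - r)) *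
        (ℓ ^ (d : ℝ) * U ^ 2)) := by
    intro h
    refine (lintegral_finiteDiff_profile_le hr0 hrS' hH hε hfε hm h).trans (le_of_eq ?_)
    congr 1
    have e1 : (‖h‖ / ℓ) ^ (2 * (S - r)) = (‖h‖ ^ (S - r) * ℓ ^ (-(S - r))) ^ 2 := by
      rw [mul_comm 2, Real.rpow_mul (by positivity), Real.rpow_two, Real.div_rpow (norm_nonneg _)
        hℓ0.le, Real.rpow_neg hℓ0.le, div_eq_mul_inv]
    have e2 : b = a * (ℓ ^ (-(S - r)) * ℓ ^ (-r)) := by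
      rw [← Real.rpow_add hℓ0, hbℓ]
      congr 2
      ring
    rw [e1, hUsq, ← hb, e2, Real.mul_rpow (by positivity) (norm_nonneg _)]
    ring
  have hres := hmain ℓ U hℓ0 hU0 f hf hf0 h0 h1 h2
  have hres' : ∫⁻ x, ENNReal.ofReal (‖fracDeriv r φ x‖ ^ p) ≤
      ENNReal.ofReal (C * (ℓ ^ (d : ℝ) * U ^ p)) := by
    refine le_trans (le_of_eq (lintegral_congr_ae ?_)) hres
    filter_upwards [hnormf] with x hx
    rw [hx]
  refine (eLpNorm_le_of_lintegral_rpow_le hp0 (by positivity) hres').trans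
    (le_of_eq ?_)
  congr 1
  rw [mul_assoc, hab, Real.mul_rpow hC.le (by positivity), Real.mul_rpow (by positivity)
    (by positivity), ← Real.rpow_mul hU0.le, mul_one_div_cancel hp0.ne', Real.rpow_one,
    ← Real.rpow_mul hℓ0.le, hU, mul_left_comm _ a, ← Real.rpow_add hℓ0]
  -- What remains is `d/p - r - d/2 = -θS`, the relation defining `θ`.
  congr 3
  rw [hθ]
  field_simp
  ring

theorem theorem1 (d : ℕ) (hd : 2 ≤ d) (r S : ℝ) (hr : 1 / 2 < r)
    (hrS : r < min ((d : ℝ) / 2) (S - 1 / 2)) :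
    lowerExponent d r S < 2 ∧
    ∀ p θ : ℝ, lowerExponent d r S < p →
      (S - r < (d : ℝ) / 2 → p ≤ 2 * (d : ℝ) / ((d : ℝ) - 2 * (S - r))) →
      1 / p = 1 / 2 + (r - θ * S) / (d : ℝ) →
      ∃ C : ℝ, 0 < C ∧
        ∀ φ : L2 d, φ ∈ sobolevRadPlus d S r ∪ sobolevRadMinus d S r →
          eLpNorm (fracDeriv r φ) (ENNReal.ofReal p) volume ≤
            ENNReal.ofReal (C * ‖φ‖ ^ (1 - θ) * ‖fracDeriv S φ‖ ^ θ) := by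
  obtain ⟨hrd, hrS'⟩ := lt_min_iff.mp hrS
  have hd0 : 0 < d := by omega
  refine ⟨lowerExponent_lt_two hr hrd hrS', fun p θ hp hpS hθ => ?_⟩
  rcases le_or_gt p 2 with hp2 | hp2
  · exact exists_eLpNorm_fracDeriv_le_of_le_two hd0 hr hrd hrS' hp hp2 hθ
  · obtain ⟨C, hC, h⟩ := exists_eLpNorm_fracDeriv_le_of_two_lt hd0 (by linarith : 0 ≤ r)
      (by linarith : r < S) hp2 hpS hθ
    refine ⟨C, hC, fun φ hφ => h φ ?_⟩
    rcases hφ with h' | h' <;> exact h'.1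

end
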